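/- Let $\Bbbk$ be a field, let $0\neq v\in\Bbbk$ be not a root of unity ($v^m\ne 1$ for all $m\ge 1$), let $n\ge 0$ be an integer, and let $\delta=\pm(v+v^{-1})$ for a fixed choice of sign. Let $\mathrm{TL}_n(\delta)$ be the unital $\Bbbk$-algebra with generators $e_1,\dots,e_{n-1}$ and relations $e_i^2=\delta e_i$, $e_ie_je_i=e_i$ if $|i-j|=1$, $e_ie_j=e_je_i$ if $|i-j|>1$. Let $\mathbf U=\mathbf U(\mathfrak{sl}_2)$ be the $\Bbbk$-algebra with generators $E,F,K^{\pm1}$ and relations $KK^{-1}=1=K^{-1}K$, $KEK^{-1}=v^2E$, $KFK^{-1}=v^{-2}F$, $EF-FE=(K-K^{-1})/(v-v^{-1})$, with coproduct $\Delta(E)=E\otimes 1+K\otimes E$, $\Delta(F)=F\otimes K^{-1}+1\otimes F$, $\Delta(K)=K\otimes K$ and counit $\epsilon(E)=\epsilon(F)=0$, $\epsilon(K)=1$. Let $V$ be the $\mathbf U$-module with basis $x_0,x_1$ and $Kx_0=vx_0$, $Kx_1=v^{-1}x_1$, $Ex_1=x_0$, $Ex_0=0$, $Fx_0=x_1$,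 $Fx_1=0$. Then $\mathbf U$ acts on $V^{\otimes n}$ through the iterated coproduct (through $\epsilon$ if $n=0$). The algebra $\mathrm{TL}_n(\delta)$ acts on $V^{\otimes n}$ by letting $e_i$ act as $\delta\cdot 1^{\otimes (i-1)}\otimes u\otimes 1^{\otimes (n-i-1)}$, where $u$ is the endomorphism of $V\otimes V$ with $u(x_0\otimes x_0)=u(x_1\otimes x_1)=0$, $u(x_0\otimes x_1)=\frac{v^{-1}}{v+v^{-1}}\,z_0$, $u(x_1\otimes x_0)=\frac{-1}{v+v^{-1}}\,z_0$, $z_0=x_0\otimes x_1-v\,x_1\otimes x_0$. For $\mu\in\mathbb Z$ let $V^{\otimes n}_\mu=\{w\in V^{\otimes n}: Kw=v^\mu w\}$. Put $\Lambda(n)=\{n,n-2,\dots,n-2\lfloor n/2\rfloor\}$. A maximal vector of weight $\mu$ is a nonzero $w\in V^{\otimes n}_\mu$ with $Ew=0$. For $\lambda\in\Lambda(n)$ let $\mathrm{Max}(\lambda)$ be the kernel of the restriction of $E$ to $V^{\otimes n}_\lambda$. A half-diagram on $n$ vertices is a planar configuration in which the vertices $1,\dots,n$ on a line are either joined in pairs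 by non-crossing links on one side of the line, or are defects (joined to infinity on that side without crossing any link). An $n$-diagram $d$ acts on a half-diagram $h$ by stacking $d$ above $h$: $dh=\delta^N h'$, where $N$ is the number of closed loops and $h'$ is the resulting half-diagram. Letting $e_i$ act as the $n$-diagram with a cup and a cap at positions $i,i+1$ and vertical strands elsewhere makes the span $\hat H$ of all half-diagrams a $\mathrm{TL}_n(\delta)$-module. The spans $\hat H^{\le\lambda}$ and $\hat H^{<\lambda}$ of the half-diagrams with at most $\lambda$, respectively fewer than $\lambda$, defects are submodules, and the cell module is $H(\lambda)=\hat H^{\le\lambda}/\hat H^{<\lambda}$. Then $V^{\otimes n}=\bigoplus_{\mu\in\pm\Lambda(n)}V^{\otimes n}_\mu$, and for each $\lambda\in\Lambda(n)$: the nonzero elements of $\mathrm{Max}(\lambda)$ are exactly the maximal vectors of weight $\lambda$; $\mathrm{Max}(\lambda)$ is a $\mathrm{TL}_n(\delta)$-submodule of $V^{\otimes n}$; and $\mathrm{Max}(\lambda)\cong H(\lambda)$ as $\mathrm{TL}_n(\delta)$-modules. -/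

import Mathlib

noncomputable section

open scoped TensorProduct

namespace TLSW

/-! ### The Temperley--Lieb algebra by generators and relations -/

/-- The defining relations of `TL_n(δ)`; the generator `e_{i+1}` of the usual indexing
is `FreeAlgebra.ι k i` with `i : Fin (n - 1)`. -/
inductive TLRel (k : Type*) [CommRing k] (n : ℕ) (δ : k) :
    FreeAlgebra k (Fin (n - 1)) → FreeAlgebra k (Fin (n - 1)) → Prop
  | sq (i : Fin (n - 1)) :
      TLRel k n δ (FreeAlgebra.ι k i * FreeAlgebra.ι k i) (δ • FreeAlgebra.ι k i)
  | braid (i j : Fin (n - 1)) (h : (i : ℕ) + 1 = j ∨ (j : ℕ) + 1 = i) :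
      TLRel k n δ (FreeAlgebra.ι k i * FreeAlgebra.ι k j * FreeAlgebra.ι k i) (FreeAlgebra.ι k i)
  | comm (i j : Fin (n - 1)) (h : (i : ℕ) + 1 < j ∨ (j : ℕ) + 1 < i) :
      TLRel k n δ (FreeAlgebra.ι k i * FreeAlgebra.ι k j)
        (FreeAlgebra.ι k j * FreeAlgebra.ι k i)

/-- The Temperley--Lieb algebra `TL_n(δ)` over `k`. -/
def TL (k : Type*) [CommRing k] (n : ℕ) (δ : k) : Type _ := RingQuot (TLRel k n δ)

instance (k : Type*) [CommRing k] (n : ℕ) (δ : k) : Ring (TL k n δ) :=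
  inferInstanceAs (Ring (RingQuot (TLRel k n δ)))

instance (k : Type*) [CommRing k] (n : ℕ) (δ : k) : Algebra k (TL k n δ) :=
  inferInstanceAs (Algebra k (RingQuot (TLRel k n δ)))

/-- The generators of `TL_n(δ)`. -/
def TL.e {k : Type*} [CommRing k] {n : ℕ} {δ : k} (i : Fin (n - 1)) : TL k n δ :=
  RingQuot.mkAlgHom k (TLRel k n δ) (FreeAlgebra.ι k i)

/-- The universal property of `TL_n(δ)`. -/
def TL.lift {k : Type*} [CommRing k] {n : ℕ} {δ : k} {A : Type*} [Ring A] [Algebra k A]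
    (f : Fin (n - 1) → A) (hsq : ∀ i, f i * f i = δ • f i)
    (hbraid : ∀ i j : Fin (n - 1), ((i : ℕ) + 1 = j ∨ (j : ℕ) + 1 = i) → f i * f j * f i = f i)
    (hcomm : ∀ i j : Fin (n - 1), (i : ℕ) + 1 < j → f i * f j = f j * f i) :
    TL k n δ →ₐ[k] A :=
  RingQuot.liftAlgHom k ⟨FreeAlgebra.lift k f, by
    intro a b h
    induction h with
    | sq i => simpa using hsq i
    | braid i j h => simpa using hbraid i j h
    | comm i j h =>
      rcases h with h | h
      · simpa using hcomm i j h
      · simpa using (hcomm j i h).symm⟩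

theorem TL.lift_e {k : Type*} [CommRing k] {n : ℕ} {δ : k} {A : Type*} [Ring A] [Algebra k A]
    (f : Fin (n - 1) → A) (hsq : ∀ i, f i * f i = δ • f i)
    (hbraid : ∀ i j : Fin (n - 1), ((i : ℕ) + 1 = j ∨ (j : ℕ) + 1 = i) → f i * f j * f i = f i)
    (hcomm : ∀ i j : Fin (n - 1), (i : ℕ) + 1 < j → f i * f j = f j * f i) (i : Fin (n - 1)) :
    TL.lift f hsq hbraid hcomm (TL.e i : TL k n δ) = f i := by
  unfold TL.lift TL.e
  exact (RingQuot.liftAlgHom_mkAlgHom_apply k _ _ _).trans (by simp)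

theorem TL.induction {k : Type*} [CommRing k] {n : ℕ} {δ : k} {P : TL k n δ → Prop}
    (halg : ∀ r : k, P (algebraMap k _ r)) (he : ∀ i, P (TL.e i))
    (hadd : ∀ a b, P a → P b → P (a + b)) (hmul : ∀ a b, P a → P b → P (a * b))
    (a : TL k n δ) : P a := by
  obtain ⟨x, rfl⟩ := RingQuot.mkAlgHom_surjective k (TLRel k n δ) a
  induction x using FreeAlgebra.induction with
  | grade0 r =>
    rw [AlgHom.commutes]
    exact halg r
  | grade1 i => exact he i
  | mul a b ha hb =>
    rw [map_mul]
    exact hmul _ _ ha hb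
  | add a b ha hb =>
    rw [map_add]
    exact hadd _ _ ha hb

/-! ### Half-diagrams and the cell modules -/

/-- A half-diagram on `n` vertices: a vertex `i` with `mate i ≠ i` is joined to `mate i` by a link,
a vertex with `mate i = i` is a defect.  Planarity: every vertex strictly under a link is itself
linked to a vertex strictly under the same link (so links do not cross, and no defect, whose arc
runs off to infinity, lies under a link). -/
@[ext]
structure HalfDiagram (n : ℕ) where
  mate : Fin n → Fin n
  mate_mate : ∀ i, mate (mate i) = i
  planar : ∀ i j, i < j → j < mate i → mate j ≠ j ∧ i < mate j ∧ mate j < mate i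

/-- The number of defects of a half-diagram. -/
def HalfDiagram.defects {n : ℕ} (h : HalfDiagram n) : ℕ :=
  (Finset.univ.filter fun i => h.mate i = i).card

/-- The left one of the two tensor positions (or vertices) on which the generator `i` acts. -/
def posL {n : ℕ} (i : Fin (n - 1)) : Fin n := ⟨i, by omega⟩

/-- The right one of the two tensor positions (or vertices) on which the generator `i` acts. -/
def posR {n : ℕ} (i : Fin (n - 1)) : Fin n := ⟨i + 1, by omega⟩

/-- The links of the half-diagram obtained by stacking the diagram of `e_i` above a half-diagram
with links `f`: the vertices `i`, `i + 1` become linked by the cup at the top of `e_i`, and a vertex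
that was joined to `i` or to `i + 1` is continued through the cap at the bottom of `e_i` to the
other one of these two vertices and from there along its link, or becomes a defect if that
other vertex is a defect. -/
def stackMate {n : ℕ} (i : Fin (n - 1)) (f : Fin n → Fin n) (j : Fin n) : Fin n :=
  if j = posL i then posR i
  else if j = posR i then posL i
  else if f j = posL i then (if f (posR i) = posR i then j else f (posR i))
  else if f j = posR i then (if f (posL i) = posL i then j else f (posL i))
  else f j

theorem posL_ne_posR {n : ℕ} (i : Fin (n - 1)) : posL i ≠ posR i := by simp [posL, posR]

theorem stackMate_stackMate {n : ℕ} (i : Fin (n - 1)) (h : HalfDiagram n) (j : Fin n) :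
    stackMate i h.mate (stackMate i h.mate j) = j := by
  have hm := h.mate_mate
  have hne := posL_ne_posR i
  unfold stackMate
  grind

set_option maxHeartbeats 4000000 in
theorem stackMate_planar {n : ℕ} (i : Fin (n - 1)) (h : HalfDiagram n) (a b : Fin n) (h1 : a < b) (h2 : b < stackMate i h.mate a) :
  stackMate i h.mate b ≠ b ∧ a < stackMate i h.mate b ∧ stackMate i h.mate b < stackMate i h.mate a := by
  have hm := h.mate_mate
  have hLR : ((posL i : Fin n) : ℕ) + 1 = (posR i : Fin n) := rfl
  have key : ∀ x y : Fin n, (x:ℕ) < y → (y:ℕ) < h.mate x → (h.mate y : ℕ) ≠ y ∧ (x:ℕ) < h.mate y ∧ (h.mate y:ℕ) < h.mate x := by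
    intro x y hx hy
    have := h.planar x y hx hy
    exact ⟨fun h => this.1 (Fin.ext h), this.2.1, this.2.2⟩
  have pl : ∀ x y : Fin n, ((x:ℕ) < y → (y:ℕ) < h.mate x → (h.mate y : ℕ) ≠ y ∧ (x:ℕ) < h.mate y ∧ (h.mate y:ℕ) < h.mate x) ∧ ((h.mate x:ℕ) < y → (y:ℕ) < x → (h.mate y : ℕ) ≠ y ∧ (h.mate x:ℕ) < h.mate y ∧ (h.mate y:ℕ) < x) := by
    intro x y
    have := key (h.mate x) y
    rw [hm] at this
    exact ⟨key x y, this⟩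
  have inj : ∀ x y : Fin n, ((h.mate x:ℕ) = y → (h.mate y : ℕ) = x) ∧ ((h.mate x:ℕ) = h.mate y → (x:ℕ) = y)∧ ((x:ℕ) = y → (h.mate x:ℕ) = h.mate y) := by
    intro x y
    refine ⟨fun e => ?_, fun e => ?_, fun e => ?_⟩
    · rw [← Fin.ext e, hm]
    · rw [← hm x, Fin.ext e, hm]
    · rw [Fin.ext e]
  unfold stackMate at *
  generalize posL i = L at *
  generalize posR i = R at *
  generalize h.mate = m at *
  have i1 := inj a b
  have i2 := inj a L
  have i3 := inj a R
  have i4 := inj b L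
  have i5 := inj b R
  have i6 := inj L R
  have i7 := inj L L
  have i8 := inj R R
  have j2 := inj L a
  have j3 := inj R a
  have j4 := inj L b
  have j5 := inj R b
  have e1 := pl a b
  have e2 := pl b a
  have e3 := pl a L
  have e4 := pl L a
  have e5 := pl b L
  have e6 := pl L b
  have e7 := pl a R
  have e8 := pl R a
  have e9 := pl b R
  have e10 := pl R b
  have e11 := pl L R
  have e12 := pl R L
  have e13 := pl L (m b)
  have e14 := pl R (m b)
  have e15 := pl a (m b)
  rw [hm] at e13 e14 e15
  clear pl key inj hm
  simp only [Fin.ext_iff, Fin.lt_def, ne_eq] at *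
  split_ifs at h2 ⊢ <;> grind

/-- The half-diagram obtained by stacking the diagram of the generator `e_i` above `h`. -/
def HalfDiagram.stack {n : ℕ} (i : Fin (n - 1)) (h : HalfDiagram n) : HalfDiagram n where
  mate := stackMate i h.mate
  mate_mate := stackMate_stackMate i h
  planar := stackMate_planar i h

/-- The number of closed loops created by stacking the diagram of `e_i` above `h`. -/
def HalfDiagram.loops {n : ℕ} (i : Fin (n - 1)) (h : HalfDiagram n) : ℕ :=
  if h.mate (posL i) = posR i then 1 else 0

theorem HalfDiagram.loops_stack_self {n : ℕ} (i : Fin (n - 1)) (h : HalfDiagram n) :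
    (h.stack i).loops i = 1 := by
  simp [loops, stack, stackMate]

theorem HalfDiagram.stack_stack_self {n : ℕ} (i : Fin (n - 1)) (h : HalfDiagram n) :
    (h.stack i).stack i = h.stack i := by
  have hm := h.mate_mate
  have hne := posL_ne_posR i
  ext1
  funext j
  simp only [stack]
  unfold stackMate
  grind

theorem HalfDiagram.loops_stack_adj {n : ℕ} (i j : Fin (n - 1)) (h : HalfDiagram n)
    (hij : (i : ℕ) + 1 = j ∨ (j : ℕ) + 1 = i) : (h.stack i).loops j = 0 := by
  have hne := posL_ne_posR i
  have hne' := posL_ne_posR j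
  have : posR i = posL j ∨ posR j = posL i := by
    simpa [posL, posR, Fin.ext_iff] using hij
  have : posL i ≠ posR j ∨ posL j ≠ posR i := by
    simp [posL, posR, Fin.ext_iff]
    omega
  have hm := h.mate_mate
  have hLL : posL i ≠ posL j := by
    simp [posL, Fin.ext_iff]
    omega
  simp only [loops, stack]
  unfold stackMate
  grind

theorem HalfDiagram.stack_braid {n : ℕ} (i j : Fin (n - 1)) (h : HalfDiagram n)
    (hij : (i : ℕ) + 1 = j ∨ (j : ℕ) + 1 = i) :
    ((h.stack i).stack j).stack i = h.stack i := by
  have hm := h.mate_mate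
  have hne := posL_ne_posR i
  have hne' := posL_ne_posR j
  ext1
  funext x
  simp only [stack]
  rcases hij with hij | hij
  · have h1 : posR i = posL j := by simpa [posL, posR, Fin.ext_iff] using hij
    have h2 : posL i ≠ posR j := by
      simp [posL, posR, Fin.ext_iff]
      omega
    unfold stackMate
    grind
  · have h1 : posR j = posL i := by simpa [posL, posR, Fin.ext_iff] using hij
    have h2 : posL j ≠ posR i := by
      simp [posL, posR, Fin.ext_iff]
      omega
    unfold stackMate
    grind

theorem HalfDiagram.stack_comm {n : ℕ} (i j : Fin (n - 1)) (h : HalfDiagram n)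
    (hij : (i : ℕ) + 1 < j) : (h.stack j).stack i = (h.stack i).stack j := by
  have hm := h.mate_mate
  have hne := posL_ne_posR i
  have hne' := posL_ne_posR j
  have h1 : posR i ≠ posL j := by
    simp [posL, posR, Fin.ext_iff]
    omega
  have h2 : posL i ≠ posR j := by
    simp [posL, posR, Fin.ext_iff]
    omega
  have h3 : posL i ≠ posL j := by
    simp [posL, Fin.ext_iff]
    omega
  have h4 : posR i ≠ posR j := by
    simp [posR, Fin.ext_iff]
    omega
  ext1
  funext x
  simp only [stack]
  have hxi : x = posL i ∨ x = posR i ∨ (x ≠ posL i ∧ x ≠ posR i) := by tauto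
  have hxj : x = posL j ∨ x = posR j ∨ (x ≠ posL j ∧ x ≠ posR j) := by tauto
  unfold stackMate
  generalize h.mate = m at hm
  generalize posL i = a at *
  generalize posR i = b at *
  generalize posL j = c at *
  generalize posR j = d at *
  clear hij h
  simp only [h1, h2, h3, h4, h1.symm, h2.symm, h3.symm, h4.symm, if_false]
  grind (splits := 25)

theorem HalfDiagram.loops_comm {n : ℕ} (i j : Fin (n - 1)) (h : HalfDiagram n)
    (hij : (i : ℕ) + 1 < j) : h.loops j + (h.stack j).loops i = h.loops i + (h.stack i).loops j := by
  have hm := h.mate_mate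
  have hne := posL_ne_posR i
  have hne' := posL_ne_posR j
  have h1 : posR i ≠ posL j := by
    simp [posL, posR, Fin.ext_iff]
    omega
  have h2 : posL i ≠ posR j := by
    simp [posL, posR, Fin.ext_iff]
    omega
  have h3 : posL i ≠ posL j := by
    simp [posL, Fin.ext_iff]
    omega
  have h4 : posR i ≠ posR j := by
    simp [posR, Fin.ext_iff]
    omega
  simp only [loops, stack]
  unfold stackMate
  grind

theorem HalfDiagram.defects_stack_le {n : ℕ} (i : Fin (n - 1)) (h : HalfDiagram n) :
    (h.stack i).defects ≤ h.defects := by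
  have hm := h.mate_mate
  have hne := posL_ne_posR i
  refine Finset.card_le_card_of_injOn
    (fun j => if h.mate j = posL i then posR i else if h.mate j = posR i then posL i else j) ?_ ?_
  · intro j hj
    simp only [stack, stackMate, Finset.coe_filter, Finset.mem_univ, true_and,
      Set.mem_ofPred_eq] at hj ⊢
    grind
  · intro j hj j' hj'
    simp only [stack, stackMate] at hj hj' ⊢
    grind

/-- The space spanned by all half-diagrams on `n` vertices (a `TL_n(δ)`-module, see below). -/
def HHat (k : Type*) [CommRing k] (n : ℕ) (_δ : k) : Type _ := HalfDiagram n →₀ k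

instance (k : Type*) [CommRing k] (n : ℕ) (δ : k) : AddCommGroup (HHat k n δ) :=
  inferInstanceAs (AddCommGroup (HalfDiagram n →₀ k))

instance (k : Type*) [CommRing k] (n : ℕ) (δ : k) : Module k (HHat k n δ) :=
  inferInstanceAs (Module k (HalfDiagram n →₀ k))

/-- A half-diagram as a basis vector. -/
def HHat.of {k : Type*} [CommRing k] {n : ℕ} (δ : k) (h : HalfDiagram n) : HHat k n δ :=
  Finsupp.single h 1

/-- The action of the generator `e_i` on half-diagrams, `e_i h = δ ^ N h'` where `h'` and the number
`N` of loops are obtained by stacking. -/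
def HHat.genAct {k : Type*} [CommRing k] {n : ℕ} (δ : k) (i : Fin (n - 1)) :
    Module.End k (HHat k n δ) :=
  Finsupp.lift (HHat k n δ) k (HalfDiagram n) fun h => δ ^ h.loops i • HHat.of δ (h.stack i)

theorem HHat.genAct_of {k : Type*} [CommRing k] {n : ℕ} (δ : k) (i : Fin (n - 1))
    (h : HalfDiagram n) :
    HHat.genAct δ i (HHat.of δ h) = δ ^ h.loops i • HHat.of δ (h.stack i) := by
  unfold HHat.genAct HHat.of
  exact (Finsupp.sum_single_index (by simp)).trans (one_smul _ _)

theorem HHat.end_ext {k : Type*} [CommRing k] {n : ℕ} {δ : k} {f g : Module.End k (HHat k n δ)}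
    (hfg : ∀ h, f (HHat.of δ h) = g (HHat.of δ h)) : f = g :=
  Finsupp.lhom_ext' fun h => LinearMap.ext_ring (hfg h)

/-- The representation of `TL_n(δ)` on the span of all half-diagrams. -/
def HHat.rep (k : Type*) [CommRing k] (n : ℕ) (δ : k) :
    TL k n δ →ₐ[k] Module.End k (HHat k n δ) :=
  TL.lift (HHat.genAct δ)
    (fun i => HHat.end_ext fun h => by
      simp [HHat.genAct_of, HalfDiagram.loops_stack_self, HalfDiagram.stack_stack_self,
        smul_smul, mul_comm])
    (fun i j hij => HHat.end_ext fun h => by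
      have hji := hij.symm
      simp [HHat.genAct_of, HalfDiagram.loops_stack_adj i j h hij,
        HalfDiagram.loops_stack_adj j i _ hji, HalfDiagram.stack_braid i j h hij])
    (fun i j hij => HHat.end_ext fun h => by
      simp [HHat.genAct_of, smul_smul, ← pow_add, HalfDiagram.loops_comm i j h hij,
        HalfDiagram.stack_comm i j h hij])

instance (k : Type*) [CommRing k] (n : ℕ) (δ : k) : Module (TL k n δ) (HHat k n δ) :=
  Module.compHom (HHat k n δ) (HHat.rep k n δ).toRingHom

theorem HHat.smul_def {k : Type*} [CommRing k] {n : ℕ} {δ : k} (a : TL k n δ) (x : HHat k n δ) :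
    a • x = HHat.rep k n δ a x := rfl

theorem HHat.e_smul_of {k : Type*} [CommRing k] {n : ℕ} {δ : k} (i : Fin (n - 1))
    (h : HalfDiagram n) :
    (TL.e i : TL k n δ) • HHat.of δ h = δ ^ h.loops i • HHat.of δ (h.stack i) := by
  rw [HHat.smul_def, HHat.rep, TL.lift_e, HHat.genAct_of]

instance (k : Type*) [CommRing k] (n : ℕ) (δ : k) : IsScalarTower k (TL k n δ) (HHat k n δ) where
  smul_assoc r a x := by simp [HHat.smul_def]

/-- The `k`-span of a set of half-diagrams closed under stacking, as a `TL_n(δ)`-submodule. -/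
def HHat.spanOf {k : Type*} [CommRing k] {n : ℕ} (δ : k) (S : Set (HalfDiagram n))
    (hS : ∀ i, ∀ h ∈ S, h.stack i ∈ S) : Submodule (TL k n δ) (HHat k n δ) where
  carrier := Submodule.span k (HHat.of δ '' S)
  add_mem' := Submodule.add_mem _
  zero_mem' := Submodule.zero_mem _
  smul_mem' a x hx := by
    induction a using TL.induction generalizing x with
    | halg r =>
      rw [algebraMap_smul]
      exact Submodule.smul_mem _ r hx
    | he i =>
      induction hx using Submodule.span_induction with
      | mem x hx =>
        obtain ⟨h, hh, rfl⟩ := hx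
        rw [HHat.e_smul_of]
        exact Submodule.smul_mem _ _ (Submodule.subset_span ⟨_, hS i h hh, rfl⟩)
      | zero => simp
      | add x y _ _ h1 h2 =>
        rw [smul_add]
        exact Submodule.add_mem _ h1 h2
      | smul r x _ h1 =>
        rw [HHat.smul_def, map_smul]
        exact Submodule.smul_mem _ r h1
    | hadd a b ha hb =>
      rw [add_smul]
      exact Submodule.add_mem _ (ha x hx) (hb x hx)
    | hmul a b ha hb =>
      rw [mul_smul]
      exact ha _ (hb x hx)

/-- The submodule spanned by the half-diagrams with at most `l` defects. -/
def HHat.le (k : Type*) [CommRing k] (n : ℕ) (δ : k) (l : ℕ) : Submodule (TL k n δ) (HHat k n δ) :=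
  HHat.spanOf δ {h | h.defects ≤ l} fun i h hh => (h.defects_stack_le i).trans hh

/-- The submodule spanned by the half-diagrams with fewer than `l` defects. -/
def HHat.lt (k : Type*) [CommRing k] (n : ℕ) (δ : k) (l : ℕ) : Submodule (TL k n δ) (HHat k n δ) :=
  HHat.spanOf δ {h | h.defects < l} fun i h hh => (h.defects_stack_le i).trans_lt hh

/-- The cell module `H(l)` of `TL_n(δ)`: the span of the half-diagrams with at most `l` defects
modulo the span of those with fewer than `l` defects. -/
abbrev CellModule (k : Type*) [CommRing k] (n : ℕ) (δ : k) (l : ℕ) : Type _ :=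
  HHat.le k n δ l ⧸ (HHat.lt k n δ l).submoduleOf (HHat.le k n δ l)

/-! ### The quantized enveloping algebra `U(sl_2)` -/

/-- Names for the four generators of `U(sl_2)`. -/
inductive UGen
  | E | F | K | Kinv

/-- The defining relations of `U(sl_2)` at the parameter `v`.  The last relation is multiplied by
`v - v⁻¹`; it is only used when `v - v⁻¹` is non-zero, that is, invertible. -/
inductive URel {k : Type*} [Field k] (v : kˣ) : FreeAlgebra k UGen → FreeAlgebra k UGen → Prop
  | K_mul_Kinv : URel v (FreeAlgebra.ι k .K * FreeAlgebra.ι k .Kinv) 1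
  | Kinv_mul_K : URel v (FreeAlgebra.ι k .Kinv * FreeAlgebra.ι k .K) 1
  | KE : URel v (FreeAlgebra.ι k .K * FreeAlgebra.ι k .E * FreeAlgebra.ι k .Kinv)
      ((v : k) ^ 2 • FreeAlgebra.ι k .E)
  | KF : URel v (FreeAlgebra.ι k .K * FreeAlgebra.ι k .F * FreeAlgebra.ι k .Kinv)
      ((v : k)⁻¹ ^ 2 • FreeAlgebra.ι k .F)
  | EF : URel v (((v : k) - (v : k)⁻¹) • (FreeAlgebra.ι k .E * FreeAlgebra.ι k .F -
        FreeAlgebra.ι k .F * FreeAlgebra.ι k .E))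
      (FreeAlgebra.ι k .K - FreeAlgebra.ι k .Kinv)

/-- The quantized enveloping algebra `U(sl_2)` over `k` at the parameter `v`. -/
def U {k : Type*} [Field k] (v : kˣ) : Type _ := RingQuot (URel v)

instance {k : Type*} [Field k] (v : kˣ) : Ring (U v) := inferInstanceAs (Ring (RingQuot (URel v)))

instance {k : Type*} [Field k] (v : kˣ) : Algebra k (U v) :=
  inferInstanceAs (Algebra k (RingQuot (URel v)))

/-- The quotient map from the free algebra. -/
def U.mk {k : Type*} [Field k] (v : kˣ) : FreeAlgebra k UGen →ₐ[k] U v :=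
  RingQuot.mkAlgHom k (URel v)

theorem U.mk_rel {k : Type*} [Field k] {v : kˣ} {a b : FreeAlgebra k UGen} (h : URel v a b) :
    U.mk v a = U.mk v b :=
  RingQuot.mkAlgHom_rel k h

/-- The generators of `U(sl_2)`. -/
def U.gen {k : Type*} [Field k] (v : kˣ) (g : UGen) : U v := U.mk v (FreeAlgebra.ι k g)

/-- The universal property of `U(sl_2)`. -/
def U.lift {k : Type*} [Field k] (v : kˣ) {A : Type*} [Ring A] [Algebra k A] (E F K Kinv : A)
    (h1 : K * Kinv = 1) (h2 : Kinv * K = 1) (hE : K * E * Kinv = (v : k) ^ 2 • E)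
    (hF : K * F * Kinv = (v : k)⁻¹ ^ 2 • F)
    (hEF : ((v : k) - (v : k)⁻¹) • (E * F - F * E) = K - Kinv) : U v →ₐ[k] A :=
  RingQuot.liftAlgHom k ⟨FreeAlgebra.lift k (UGen.rec E F K Kinv), by
    intro a b h
    induction h with
    | K_mul_Kinv => simpa using h1
    | Kinv_mul_K => simpa using h2
    | KE => simpa using hE
    | KF => simpa using hF
    | EF => simpa using hEF⟩

theorem U.lift_gen {k : Type*} [Field k] (v : kˣ) {A : Type*} [Ring A] [Algebra k A]
    (E F K Kinv : A)
    (h1 : K * Kinv = 1) (h2 : Kinv * K = 1) (hE : K * E * Kinv = (v : k) ^ 2 • E)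
    (hF : K * F * Kinv = (v : k)⁻¹ ^ 2 • F)
    (hEF : ((v : k) - (v : k)⁻¹) • (E * F - F * E) = K - Kinv) (g : UGen) :
    U.lift v E F K Kinv h1 h2 hE hF hEF (U.gen v g) = UGen.rec E F K Kinv g := by
  unfold U.lift U.gen U.mk
  exact (RingQuot.liftAlgHom_mkAlgHom_apply k _ _ _).trans (by simp)

theorem U.K_mul_Kinv {k : Type*} [Field k] (v : kˣ) : U.gen v .K * U.gen v .Kinv = 1 := by
  unfold U.gen
  rw [← map_mul]
  exact (U.mk_rel URel.K_mul_Kinv).trans (map_one _)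

theorem U.Kinv_mul_K {k : Type*} [Field k] (v : kˣ) : U.gen v .Kinv * U.gen v .K = 1 := by
  unfold U.gen
  rw [← map_mul]
  exact (U.mk_rel URel.Kinv_mul_K).trans (map_one _)

theorem U.K_mul_E {k : Type*} [Field k] (v : kˣ) :
    U.gen v .K * U.gen v .E * U.gen v .Kinv = (v : k) ^ 2 • U.gen v .E := by
  unfold U.gen
  rw [← map_mul, ← map_mul]
  exact (U.mk_rel URel.KE).trans (map_smul _ _ _)

theorem U.K_mul_F {k : Type*} [Field k] (v : kˣ) :
    U.gen v .K * U.gen v .F * U.gen v .Kinv = (v : k)⁻¹ ^ 2 • U.gen v .F := by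
  unfold U.gen
  rw [← map_mul, ← map_mul]
  exact (U.mk_rel URel.KF).trans (map_smul _ _ _)

theorem U.E_mul_F {k : Type*} [Field k] (v : kˣ) :
    ((v : k) - (v : k)⁻¹) • (U.gen v .E * U.gen v .F - U.gen v .F * U.gen v .E) =
      U.gen v .K - U.gen v .Kinv := by
  unfold U.gen
  rw [← map_mul, ← map_mul, ← map_sub, ← map_sub, ← map_smul]
  exact U.mk_rel URel.EF

theorem U.K_comm_E {k : Type*} [Field k] (v : kˣ) :
    U.gen v .K * U.gen v .E = (v : k) ^ 2 • (U.gen v .E * U.gen v .K) := by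
  rw [← smul_mul_assoc, ← U.K_mul_E, mul_assoc, U.Kinv_mul_K, mul_one]

theorem U.K_comm_F {k : Type*} [Field k] (v : kˣ) :
    U.gen v .K * U.gen v .F = (v : k)⁻¹ ^ 2 • (U.gen v .F * U.gen v .K) := by
  rw [← smul_mul_assoc, ← U.K_mul_F, mul_assoc, U.Kinv_mul_K, mul_one]

theorem U.E_comm_Kinv {k : Type*} [Field k] (v : kˣ) :
    U.gen v .E * U.gen v .Kinv = (v : k) ^ 2 • (U.gen v .Kinv * U.gen v .E) := by
  have h := congrArg (U.gen v .Kinv * ·) (U.K_mul_E v)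
  simp only [← mul_assoc, U.Kinv_mul_K, one_mul, mul_smul_comm] at h
  exact h

/-- The coproduct `Δ(E) = E ⊗ 1 + K ⊗ E`, `Δ(F) = F ⊗ K⁻¹ + 1 ⊗ F`, `Δ(K) = K ⊗ K`. -/
def U.comul {k : Type*} [Field k] (v : kˣ) : U v →ₐ[k] U v ⊗[k] U v :=
  U.lift v
    (U.gen v .E ⊗ₜ 1 + U.gen v .K ⊗ₜ U.gen v .E)
    (U.gen v .F ⊗ₜ U.gen v .Kinv + 1 ⊗ₜ U.gen v .F)
    (U.gen v .K ⊗ₜ U.gen v .K)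
    (U.gen v .Kinv ⊗ₜ U.gen v .Kinv)
    (by simp [U.K_mul_Kinv, Algebra.TensorProduct.one_def])
    (by simp [U.Kinv_mul_K, Algebra.TensorProduct.one_def])
    (by
      simp only [mul_add, add_mul, Algebra.TensorProduct.tmul_mul_tmul, U.K_mul_E, mul_one,
        U.K_mul_Kinv, mul_assoc (U.gen v .K) (U.gen v .K), TensorProduct.smul_tmul',
        TensorProduct.tmul_smul, smul_add])
    (by
      simp only [mul_add, add_mul, Algebra.TensorProduct.tmul_mul_tmul, U.K_mul_F, mul_one,
        U.K_mul_Kinv, one_mul, TensorProduct.smul_tmul',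
        TensorProduct.tmul_smul, smul_add])
    (by
      have h : ((U.gen v .K * U.gen v .F) ⊗ₜ[k] (U.gen v .E * U.gen v .Kinv) : U v ⊗[k] U v) =
          (U.gen v .F * U.gen v .K) ⊗ₜ[k] (U.gen v .Kinv * U.gen v .E) := by
        rw [U.K_comm_F, U.E_comm_Kinv, TensorProduct.smul_tmul, smul_smul, ← mul_pow,
          inv_mul_cancel₀ v.ne_zero, one_pow, one_smul]
      have h2 : ((U.gen v .E + 0) = U.gen v .E) := add_zero _
      simp only [mul_add, add_mul, Algebra.TensorProduct.tmul_mul_tmul, mul_one, one_mul, h]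
      have h3 : ∀ a b c d e f : U v ⊗[k] U v, a + b + (c + d) - (e + c + (b + f)) = (a - e) + (d - f) := by
        intros; abel
      have h4 := U.E_mul_F v
      rw [h3, ← TensorProduct.sub_tmul, ← TensorProduct.tmul_sub, smul_add,
        TensorProduct.smul_tmul', ← TensorProduct.tmul_smul, h4]
      simp only [TensorProduct.sub_tmul, TensorProduct.tmul_sub]
      abel)

/-- The counit `ε(E) = ε(F) = 0`, `ε(K) = 1`. -/
def U.counit {k : Type*} [Field k] (v : kˣ) : U v →ₐ[k] k :=
  U.lift v 0 0 1 1 (by simp) (by simp) (by simp) (by simp) (by simp)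

/-! ### Tensor space as a module over `U(sl_2)` -/

/-- The underlying space of the natural module `V`, with basis `x_0, x_1`
(the standard basis vectors). -/
abbrev V (k : Type*) [Field k] : Type _ := Fin 2 → k

/-- The natural module `V = V(1)`: `E x_1 = x_0`, `E x_0 = 0`, `F x_0 = x_1`, `F x_1 = 0`,
`K x_0 = v x_0`, `K x_1 = v⁻¹ x_1`. -/
def natRep {k : Type*} [Field k] (v : kˣ) : U v →ₐ[k] Module.End k (V k) :=
  (Matrix.toLinAlgEquiv' : Matrix (Fin 2) (Fin 2) k ≃ₐ[k] _).toAlgHom.comp <|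
    U.lift v !![0, 1; 0, 0] !![0, 0; 1, 0] !![(v : k), 0; 0, (v : k)⁻¹] !![(v : k)⁻¹, 0; 0, (v : k)]
      (by simp [Matrix.one_fin_two])
      (by simp [Matrix.one_fin_two])
      (by ext i j; fin_cases i <;> fin_cases j <;> simp [pow_two])
      (by ext i j; fin_cases i <;> fin_cases j <;> simp [pow_two])
      (by simp)

/-- The tensor power `V^{⊗ n}`. -/
abbrev TensorSpace (k : Type*) [Field k] (n : ℕ) : Type _ := ⨂[k]^n (V k)

/-- The identification `V^{⊗ n} ⊗ V = V^{⊗ (n + 1)}`. -/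
def tensorSucc (k : Type*) [Field k] (n : ℕ) :
    TensorSpace k n ⊗[k] V k ≃ₗ[k] TensorSpace k (n + 1) :=
  (TensorProduct.congr (LinearEquiv.refl k _)
    (PiTensorProduct.subsingletonEquiv (R := k) (s := fun _ : Fin 1 => V k) 0).symm).trans
      TensorPower.mulEquiv

/-- The action of `U(sl_2)` on `V^{⊗ n}` through the iterated coproduct
`Δ^{(n + 1)} = (Δ ⊗ 1^{⊗ (n - 1)}) Δ^{(n)}`: reading `V^{⊗ (n + 1)}` as `V^{⊗ n} ⊗ V`,
an element `a` acts by `Δ(a)`. For `n = 0` this is the trivial module, given by the counit. -/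
def tensorRep {k : Type*} [Field k] (v : kˣ) : (n : ℕ) → U v →ₐ[k] Module.End k (TensorSpace k n)
  | 0 => (Algebra.ofId k _).comp (U.counit v)
  | n + 1 => (tensorSucc k n).conjAlgEquiv k |>.toAlgHom.comp <|
      (Module.endTensorEndAlgHom (R := k) (S := k) (A := k)).comp <|
        (Algebra.TensorProduct.map (tensorRep v n) (natRep v)).comp (U.comul v)

/-- `K` acts on the weight space of weight `μ` by the scalar `v ^ μ`. -/
def weightSpace {k : Type*} [Field k] (v : kˣ) (n : ℕ) (μ : ℤ) : Submodule k (TensorSpace k n) :=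
  Module.End.eigenspace (tensorRep v n (U.gen v .K)) (((v ^ μ : kˣ)) : k)

/-! ### Tensor space as a module over the Temperley--Lieb algebra -/

/-- The matrix of the projection `u` of `V ⊗ V` onto the span of `x_0 ⊗ x_1 - v x_1 ⊗ x_0`
with respect to the basis `x_0 ⊗ x_0`, `x_0 ⊗ x_1`, `x_1 ⊗ x_0`, `x_1 ⊗ x_1`. -/
def uMatrix {k : Type*} [Field k] (v : kˣ) : Matrix (Fin 4) (Fin 4) k :=
  ((v : k) + (v : k)⁻¹)⁻¹ •
    !![0, 0, 0, 0;
       0, (v : k)⁻¹, -1, 0;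
       0, -1, (v : k), 0;
       0, 0, 0, 0]

/-- The matrix unit `E_{p q}`, sending `x_q` to `x_p` and the other basis vector to `0`. -/
def matrixUnit (k : Type*) [Field k] (p q : Fin 2) : Module.End k (V k) :=
  Matrix.toLin' (Matrix.single p q (1 : k))

/-- The endomorphism of `V^{⊗ n}` which is `A` (an endomorphism of `V ⊗ V`, given by its matrix with
respect to the basis `x_0 ⊗ x_0`, `x_0 ⊗ x_1`, `x_1 ⊗ x_0`, `x_1 ⊗ x_1`) on the tensor positions
`posL i`, `posR i` and the identity on the others: `A` is written as a combination of the tensor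
products of matrix units `E_{p.1 q.1} ⊗ E_{p.2 q.2}`. -/
def atPair {k : Type*} [Field k] {n : ℕ} (i : Fin (n - 1)) (A : Matrix (Fin 4) (Fin 4) k) :
    Module.End k (TensorSpace k n) :=
  ∑ p : Fin 2 × Fin 2, ∑ q : Fin 2 × Fin 2, A (finProdFinEquiv p) (finProdFinEquiv q) •
    PiTensorProduct.map fun j =>
      if j = posL i then matrixUnit k p.1 q.1
      else if j = posR i then matrixUnit k p.2 q.2
      else LinearMap.id

/-- The parameter `δ = ±(v + v⁻¹)`, the sign being `ε`. -/
def loopValue {k : Type*} [Field k] (v : kˣ) (ε : ℤˣ) : k := ((ε : ℤ) : k) * ((v : k) + (v : k)⁻¹)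

/-- The operator `± (v + v⁻¹) 1^{⊗ (i - 1)} ⊗ u ⊗ 1^{⊗ (n - i - 1)}` by which `e_i` acts. -/
def tensorGen {k : Type*} [Field k] (v : kˣ) (ε : ℤˣ) {n : ℕ} (i : Fin (n - 1)) :
    Module.End k (TensorSpace k n) :=
  loopValue v ε • atPair i (uMatrix v)

/-- The basis vector `x_{a 0} ⊗ x_{a 1} ⊗ ⋯` of `V^{⊗ n}`. -/
def xvec (k : Type*) [Field k] {n : ℕ} (a : Fin n → Fin 2) : TensorSpace k n :=
  PiTensorProduct.tprod k fun j => (Pi.single (a j) 1 : V k)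

theorem tensor_end_ext {k : Type*} [Field k] {n : ℕ} {f g : Module.End k (TensorSpace k n)}
    (h : ∀ a, f (xvec k a) = g (xvec k a)) : f = g := by
  refine (Basis.piTensorProduct fun _ : Fin n => Pi.basisFun k (Fin 2)).ext fun a => ?_
  rw [Basis.piTensorProduct_apply]
  simpa [xvec] using h a

theorem matrixUnit_single {k : Type*} [Field k] (p q a : Fin 2) :
    matrixUnit k p q (Pi.single a 1) =
      if q = a then (Pi.single p 1 : V k) else 0 := by
  fin_cases p <;> fin_cases q <;> fin_cases a <;> ext i <;> fin_cases i <;>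
    simp [matrixUnit, Matrix.single]

theorem atPair_xvec {k : Type*} [Field k] {n : ℕ} (i : Fin (n - 1)) (A : Matrix (Fin 4) (Fin 4) k)
    (a : Fin n → Fin 2) :
    atPair i A (xvec k a) = ∑ p : Fin 2 × Fin 2,
      A (finProdFinEquiv p) (finProdFinEquiv (a (posL i), a (posR i))) •
        xvec k (Function.update (Function.update a (posL i) p.1) (posR i) p.2) := by
  have hne := posL_ne_posR i
  simp only [atPair, LinearMap.sum_apply, LinearMap.smul_apply]
  refine Finset.sum_congr rfl fun p _ => ?_
  rw [Finset.sum_eq_single (a (posL i), a (posR i))]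
  · congr 1
    unfold xvec
    rw [PiTensorProduct.map_tprod]
    congr 1
    funext j
    by_cases h1 : j = posL i
    · subst h1
      simp [hne, matrixUnit_single]
    · by_cases h2 : j = posR i
      · subst h2
        simp [hne.symm, matrixUnit_single]
      · simp [h1, h2]
  · intro q _ hq
    rw [xvec, PiTensorProduct.map_tprod]
    have : q.1 ≠ a (posL i) ∨ q.2 ≠ a (posR i) := by
      by_contra! h
      exact hq (Prod.ext h.1 h.2)
    rcases this with h | h
    · rw [(PiTensorProduct.tprod k).map_coord_zero (posL i), smul_zero]
      simp [h, matrixUnit_single]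
    · rw [(PiTensorProduct.tprod k).map_coord_zero (posR i), smul_zero]
      simp [h, hne.symm, matrixUnit_single]
  · simp

theorem loopValue_mul_self_inv {k : Type*} [Field k] (v : kˣ) (ε : ℤˣ)
    (hv : (v : k) + (v : k)⁻¹ ≠ 0) :
    loopValue v ε * ((v : k) + (v : k)⁻¹)⁻¹ = ((ε : ℤ) : k) := by
  rw [loopValue, mul_assoc, mul_inv_cancel₀ hv, mul_one]

theorem tensorGen_xvec_same {k : Type*} [Field k] (v : kˣ) (ε : ℤˣ) {n : ℕ} (i : Fin (n - 1))
    (a : Fin n → Fin 2) (h : a (posL i) = a (posR i)) : tensorGen v ε i (xvec k a) = 0 := by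
  rw [tensorGen, LinearMap.smul_apply, atPair_xvec, h]
  generalize a (posR i) = t
  fin_cases t <;>
  simp [Fintype.sum_prod_type, uMatrix, finProdFinEquiv]

theorem tensorGen_xvec_01 {k : Type*} [Field k] (v : kˣ) (ε : ℤˣ) (hv : (v : k) + (v : k)⁻¹ ≠ 0)
    {n : ℕ} (i : Fin (n - 1)) (a : Fin n → Fin 2) (h0 : a (posL i) = 0) (h1 : a (posR i) = 1) :
    tensorGen v ε i (xvec k a) = ((ε : ℤ) : k) • ((v : k)⁻¹ • xvec k a -
      xvec k (Function.update (Function.update a (posL i) 1) (posR i) 0)) := by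
  have ha : Function.update (Function.update a (posL i) 0) (posR i) 1 = a := by
    rw [← h0, Function.update_eq_self, ← h1, Function.update_eq_self]
  rw [tensorGen, LinearMap.smul_apply, atPair_xvec, h0, h1]
  simp [Fintype.sum_prod_type, uMatrix, finProdFinEquiv, ha, smul_add, smul_smul,
    ← mul_assoc, loopValue_mul_self_inv v ε hv, sub_eq_add_neg]

theorem tensorGen_xvec_10 {k : Type*} [Field k] (v : kˣ) (ε : ℤˣ) (hv : (v : k) + (v : k)⁻¹ ≠ 0)
    {n : ℕ} (i : Fin (n - 1)) (a : Fin n → Fin 2) (h0 : a (posL i) = 1) (h1 : a (posR i) = 0) :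
    tensorGen v ε i (xvec k a) = ((ε : ℤ) : k) • ((v : k) • xvec k a -
      xvec k (Function.update (Function.update a (posL i) 0) (posR i) 1)) := by
  have ha : Function.update (Function.update a (posL i) 1) (posR i) 0 = a := by
    rw [← h0, Function.update_eq_self, ← h1, Function.update_eq_self]
  rw [tensorGen, LinearMap.smul_apply, atPair_xvec, h0, h1]
  simp [Fintype.sum_prod_type, uMatrix, finProdFinEquiv, ha, smul_add, smul_smul,
    ← mul_assoc, loopValue_mul_self_inv v ε hv, sub_eq_add_neg, add_comm]

theorem loopValue_eq_zero {k : Type*} [Field k] (v : kˣ) (ε : ℤˣ)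
    (hv : (v : k) + (v : k)⁻¹ = 0) : loopValue v ε = 0 := by
  rw [loopValue, hv, mul_zero]

theorem tensorGen_eq_zero {k : Type*} [Field k] (v : kˣ) (ε : ℤˣ)
    (hv : (v : k) + (v : k)⁻¹ = 0) {n : ℕ} (i : Fin (n - 1)) :
    (tensorGen v ε i : Module.End k (TensorSpace k n)) = 0 := by
  rw [tensorGen, loopValue_eq_zero v ε hv, zero_smul]

theorem sign_mul_self (k : Type*) [Field k] (ε : ℤˣ) : ((ε : ℤ) : k) * ((ε : ℤ) : k) = 1 := by
  rcases Int.units_eq_one_or ε with rfl | rfl <;> simp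

theorem fin2_cases (t : Fin 2) : t = 0 ∨ t = 1 := by
  fin_cases t <;> simp

theorem sq_aux01 {k M : Type*} [Field k] [AddCommGroup M] [Module k M] (s v : k) (hv : v ≠ 0)
    (x y : M) : s • (v⁻¹ • (s • (v⁻¹ • x - y)) - s • (v • y - x)) =
      (s * (v + v⁻¹)) • s • (v⁻¹ • x - y) := by
  match_scalars <;> field_simp <;> ring

theorem sq_aux10 {k M : Type*} [Field k] [AddCommGroup M] [Module k M] (s v : k) (hv : v ≠ 0)
    (x y : M) : s • (v • (s • (v • x - y)) - s • (v⁻¹ • y - x)) =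
      (s * (v + v⁻¹)) • s • (v • x - y) := by
  match_scalars <;> field_simp <;> ring

theorem tensorGen_sq {k : Type*} [Field k] (v : kˣ) (ε : ℤˣ) {n : ℕ} (i : Fin (n - 1)) :
    (tensorGen v ε i : Module.End k (TensorSpace k n)) * tensorGen v ε i =
      loopValue v ε • tensorGen v ε i := by
  by_cases hv : (v : k) + (v : k)⁻¹ = 0
  · simp [tensorGen_eq_zero v ε hv]
  refine tensor_end_ext fun a => ?_
  have hne := posL_ne_posR i
  have hv0 := v.ne_zero
  rw [Module.End.mul_apply, LinearMap.smul_apply, loopValue]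
  have hu : ∀ s t s' t' : Fin 2, Function.update (Function.update (Function.update
      (Function.update a (posL i) s) (posR i) t) (posL i) s') (posR i) t' =
      Function.update (Function.update a (posL i) s') (posR i) t' := by
    intro s t s' t'
    funext j
    simp only [Function.update_apply]
    grind
  rcases fin2_cases (a (posL i)) with h0 | h0 <;> rcases fin2_cases (a (posR i)) with h1 | h1
  · simp [tensorGen_xvec_same v ε i a (h0.trans h1.symm)]
  · have ha : Function.update (Function.update a (posL i) 0) (posR i) 1 = a := by
      rw [← h0, Function.update_eq_self, ← h1, Function.update_eq_self]
    rw [tensorGen_xvec_01 v ε hv i a h0 h1, map_smul, map_sub, map_smul,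
      tensorGen_xvec_01 v ε hv i a h0 h1, tensorGen_xvec_10 v ε hv i _ (by simp [hne]) (by simp),
      hu, ha]
    exact sq_aux01 (M := TensorSpace k n) _ _ hv0 _ _
  · have ha : Function.update (Function.update a (posL i) 1) (posR i) 0 = a := by
      rw [← h0, Function.update_eq_self, ← h1, Function.update_eq_self]
    rw [tensorGen_xvec_10 v ε hv i a h0 h1, map_smul, map_sub, map_smul,
      tensorGen_xvec_10 v ε hv i a h0 h1, tensorGen_xvec_01 v ε hv i _ (by simp [hne]) (by simp),
      hu, ha]
    exact sq_aux10 (M := TensorSpace k n) _ _ hv0 _ _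
  · simp [tensorGen_xvec_same v ε i a (h0.trans h1.symm)]

theorem tensorGen_comm {k : Type*} [Field k] (v : kˣ) (ε : ℤˣ) {n : ℕ} (i j : Fin (n - 1))
    (hij : (i : ℕ) + 1 < j) :
    (tensorGen v ε i : Module.End k (TensorSpace k n)) * tensorGen v ε j =
      tensorGen v ε j * tensorGen v ε i := by
  have hi := posL_ne_posR i
  have hj := posL_ne_posR j
  have h1 : posR i ≠ posL j := by
    simp [posL, posR, Fin.ext_iff]
    omega
  have h2 : posL i ≠ posR j := by
    simp [posL, posR, Fin.ext_iff]
    omega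
  have h3 : posL i ≠ posL j := by
    simp [posL, Fin.ext_iff]
    omega
  have h4 : posR i ≠ posR j := by
    simp [posR, Fin.ext_iff]
    omega
  refine tensor_end_ext fun a => ?_
  simp only [Module.End.mul_apply, tensorGen, LinearMap.smul_apply, map_smul, atPair_xvec, map_sum,
    Function.update_of_ne h1, Function.update_of_ne h2, Function.update_of_ne h3,
    Function.update_of_ne h4, Function.update_of_ne h1.symm, Function.update_of_ne h2.symm,
    Function.update_of_ne h3.symm, Function.update_of_ne h4.symm, Finset.smul_sum, smul_smul]
  rw [Finset.sum_comm]
  refine Finset.sum_congr rfl fun p _ => Finset.sum_congr rfl fun q _ => ?_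
  congr 1
  · ring
  · congr 1
    funext x
    simp only [Function.update_apply]
    grind

theorem braid_aux {k M : Type*} [Field k] [AddCommGroup M] [Module k M] (s v : k) (hs : s * s = 1)
    (hv : v ≠ 0) (A B : M →ₗ[k] M) (X : Fin 2 → Fin 2 → Fin 2 → M)
    (hA : ∀ p r, A (X p p r) = 0) (hB : ∀ p r, B (X r p p) = 0)
    (hA01 : ∀ r, A (X 0 1 r) = s • (v⁻¹ • X 0 1 r - X 1 0 r))
    (hA10 : ∀ r, A (X 1 0 r) = s • (v • X 1 0 r - X 0 1 r))
    (hB01 : ∀ r, B (X r 0 1) = s • (v⁻¹ • X r 0 1 - X r 1 0))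
    (hB10 : ∀ r, B (X r 1 0) = s • (v • X r 1 0 - X r 0 1)) (p q r : Fin 2) :
    A (B (A (X p q r))) = A (X p q r) ∧ B (A (B (X p q r))) = B (X p q r) := by
  have key : ∀ x : M, s • s • x = x := fun x => by rw [smul_smul, hs, one_smul]
  have hv1 : ∀ x : M, v • v⁻¹ • x = x := fun x => smul_inv_smul₀ hv x
  have hv2 : ∀ x : M, v⁻¹ • v • x = x := fun x => inv_smul_smul₀ hv x
  have c1 : ∀ x : M, v⁻¹ • s • x = s • v⁻¹ • x := fun x => smul_comm _ _ _
  have c2 : ∀ x : M, v • s • x = s • v • x := fun x => smul_comm _ _ _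
  rcases fin2_cases p with rfl | rfl <;> rcases fin2_cases q with rfl | rfl <;>
    rcases fin2_cases r with rfl | rfl <;> constructor <;>
    simp [hA, hB, hA01, hA10, hB01, hB10, key, hv1, hv2, c1, c2, smul_sub]

/-- The sequence `a` with the entries at three positions replaced. -/
def update3 {n : ℕ} (a : Fin n → Fin 2) (P Q R : Fin n) (p q r : Fin 2) : Fin n → Fin 2 :=
  fun x => if x = P then p else if x = Q then q else if x = R then r else a x

theorem tensorGen_braid_main {k : Type*} [Field k] (v : kˣ) (ε : ℤˣ)
    (hv : (v : k) + (v : k)⁻¹ ≠ 0) {n : ℕ} (i j : Fin (n - 1)) (hij : (i : ℕ) + 1 = j)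
    (a : Fin n → Fin 2) (p q r : Fin 2) (x : TensorSpace k n)
    (hx : x = xvec k (update3 a (posL i) (posR i) (posR j) p q r)) :
    tensorGen v ε i (tensorGen v ε j (tensorGen v ε i x)) = tensorGen v ε i x ∧
      tensorGen v ε j (tensorGen v ε i (tensorGen v ε j x)) = tensorGen v ε j x := by
  have hi := posL_ne_posR i
  have hj := posL_ne_posR j
  have h1 : posR i = posL j := by simpa [posL, posR, Fin.ext_iff] using hij
  have h2 : posL i ≠ posR j := by
    simp [posL, posR, Fin.ext_iff]
    omega
  subst hx
  exact
    braid_aux (M := TensorSpace k n) ((ε : ℤ) : k) (v : k) (sign_mul_self k ε) v.ne_zero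
      (tensorGen v ε i) (tensorGen v ε j)
      (fun p q r => xvec k (update3 a (posL i) (posR i) (posR j) p q r))
      (fun p r => tensorGen_xvec_same v ε i _ (by simp [update3, hi.symm]))
      (fun p r => tensorGen_xvec_same v ε j _ (by simp [update3, h1, h2.symm, hj.symm, (h1 ▸ hi).symm]))
      (fun r => by
        rw [tensorGen_xvec_01 v ε hv i _ (by simp [update3]) (by simp [update3, hi.symm])]
        congr 3
        funext x
        simp only [update3, Function.update_apply]
        grind)
      (fun r => by
        rw [tensorGen_xvec_10 v ε hv i _ (by simp [update3]) (by simp [update3, hi.symm])]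
        congr 3
        funext x
        simp only [update3, Function.update_apply]
        grind)
      (fun r => by
        rw [tensorGen_xvec_01 v ε hv j _ (by simp only [update3]; grind)
          (by simp only [update3]; grind)]
        congr 3
        funext x
        simp only [update3, Function.update_apply]
        grind)
      (fun r => by
        rw [tensorGen_xvec_10 v ε hv j _ (by simp only [update3]; grind)
          (by simp only [update3]; grind)]
        congr 3
        funext x
        simp only [update3, Function.update_apply]
        grind)
      p q r

theorem update3_self {n : ℕ} (a : Fin n → Fin 2) (P Q R : Fin n) :
    a = update3 a P Q R (a P) (a Q) (a R) := by
  funext x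
  simp only [update3]
  grind

theorem tensorGen_braid_aux {k : Type*} [Field k] (v : kˣ) (ε : ℤˣ) {n : ℕ} (i j : Fin (n - 1))
    (hij : (i : ℕ) + 1 = j) :
    (tensorGen v ε i : Module.End k (TensorSpace k n)) * tensorGen v ε j * tensorGen v ε i =
      tensorGen v ε i ∧
    (tensorGen v ε j : Module.End k (TensorSpace k n)) * tensorGen v ε i * tensorGen v ε j =
      tensorGen v ε j := by
  by_cases hv : (v : k) + (v : k)⁻¹ = 0
  · simp [tensorGen_eq_zero v ε hv]
  have main := fun a => tensorGen_braid_main v ε hv i j hij a _ _ _ (xvec k a)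
    (congrArg (xvec k) (update3_self a (posL i) (posR i) (posR j)))
  constructor
  · refine tensor_end_ext fun a => ?_
    rw [Module.End.mul_apply, Module.End.mul_apply]
    exact (main a).1
  · refine tensor_end_ext fun a => ?_
    rw [Module.End.mul_apply, Module.End.mul_apply]
    exact (main a).2

theorem tensorGen_braid {k : Type*} [Field k] (v : kˣ) (ε : ℤˣ) {n : ℕ} (i j : Fin (n - 1))
    (hij : (i : ℕ) + 1 = j ∨ (j : ℕ) + 1 = i) :
    (tensorGen v ε i : Module.End k (TensorSpace k n)) * tensorGen v ε j * tensorGen v ε i =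
      tensorGen v ε i := by
  rcases hij with h | h
  · exact (tensorGen_braid_aux v ε i j h).1
  · exact (tensorGen_braid_aux v ε j i h).2

/-- The representation of `TL_n(δ)`, `δ = ±(v + v⁻¹)`, on `V^{⊗ n}`. -/
def tensorTLRep {k : Type*} [Field k] (v : kˣ) (ε : ℤˣ) (n : ℕ) :
    TL k n (loopValue v ε) →ₐ[k] Module.End k (TensorSpace k n) :=
  TL.lift (tensorGen v ε) (tensorGen_sq v ε) (tensorGen_braid v ε) (tensorGen_comm v ε)

/-! ### Weights and maximal vectors -/

/-- `Λ(n) = {n, n - 2, …, n - 2 ⌊n / 2⌋}`. -/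
def cellIndex (n : ℕ) : Finset ℕ := (Finset.range (n / 2 + 1)).image fun p => n - 2 * p

/-- `±Λ(n)`. -/
def signedIndex (n : ℕ) : Finset ℤ :=
  (cellIndex n).image (fun l : ℕ => (l : ℤ)) ∪ (cellIndex n).image (fun l : ℕ => -(l : ℤ))

/-- The space `Max(l)`: the kernel of the restriction of `E` to the weight space of weight `l`. -/
def maxSpace {k : Type*} [Field k] (v : kˣ) (n : ℕ) (l : ℕ) : Submodule k (TensorSpace k n) :=
  (LinearMap.ker ((tensorRep v n (U.gen v .E)).domRestrict (weightSpace v n l))).map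
    (weightSpace v n l).subtype

/-- A maximal (highest weight) vector of weight `μ` in a representation `ρ` of `U(sl_2)`: a non-zero
vector on which `K` acts by the scalar `v ^ μ` and which is killed by `E`. -/
structure IsMaximalVector {k M : Type*} [Field k] [AddCommGroup M] [Module k M] (v : kˣ)
    (ρ : U v →ₐ[k] Module.End k M) (μ : ℤ) (w : M) : Prop where
  ne_zero : w ≠ 0
  weight : ρ (U.gen v .K) w = ((v ^ μ : kˣ) : k) • w
  killed : ρ (U.gen v .E) w = 0

end TLSW

end

noncomputable section

open scoped TensorProduct

namespace TLSW

/-! In the basis of tensors in `x_0` and `x_1`, a vector of tensor space is a function on sequences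
`Fin n → Fin 2`, and `E`, `K`, `e_i` become the explicit operators `raise`, `torus`, `coordGen`. As
`v` is not a root of unity, the scalars `v ^ μ` are distinct, so a weight space is spanned by the
basis tensors of that weight; this gives the weight decomposition.

The isomorphism sends a half-diagram with `l` defects to its link vector `linkVec`: a factor `x_0`
at every defect and, for a link from `i` to `j > i`, the tensor `x_0 ⊗ x_1 - v x_1 ⊗ x_0` in these
two positions, with the sign `(-ε) ^ j`. This vector has weight `l` (`linkVec_mem`) and is killed by
`E` (`raise_linkVec`): by planarity the tensor factors under a link have total weight zero, so the
contributions of `E` at the two ends of the link cancel. The generator `e_i` multiplies a link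
vector by `δ` if stacking closes a loop, and kills it if `i` and `i + 1` are both defects, when
stacking lowers the number of defects. Otherwise it gives the link vector of the stacked diagram
(`coordGen_linkVec`): `e_i` produces a factor `-ε`, which the signs absorb because the ends of a
link have opposite parity. Hence the map is equivariant modulo fewer defects.

Bijectivity goes by induction on `n`, writing `f = f_0 ⊗ x_0 + f_1 ⊗ x_1`, for which `E f = (E f_0 +
K f_1) ⊗ x_0 + E f_1 ⊗ x_1`. Link vectors are independent (`linearIndependent_linkVec`) because
removing the last vertex is injective on the diagrams where it is linked and on those where it is a
defect. They span (`mem_span_linkVec`): `f_1` is killed by `E` and has weight `l + 1`, so it is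
matched by linking a new vertex to the last defect; what is left has `f_1 = 0` and `f_0` of weight
`l - 1` killed by `E`, so it is matched by adding a defect. For `l = 0` the latter must vanish,
because `E ^ m` is injective on weight `-m` (`eq_zero_of_raise_pow_eq_zero`), a consequence of
quantum integers being nonzero.

Stability of `Max(l)` under the Temperley--Lieb algebra then comes for free, since `Max(l)` is the
image of an equivariant map. -/

variable {k : Type*} [Field k]

/-! ### Tensor space in coordinates: the operators `E` and `K`. -/

/-- The weight of `x_t`, an exponent of `v`. -/
def siteWeight (t : Fin 2) : ℤ := if t = 0 then 1 else -1

/-- The weight of the basis vector `xvec k b`. -/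
def seqWeight {n : ℕ} (b : Fin n → Fin 2) : ℤ := ∑ p, siteWeight (b p)

/-- The weight of the part of a sequence strictly to the left of the position `p`. -/
def prefixWeight {n : ℕ} (b : Fin n → Fin 2) (p : Fin n) : ℤ :=
  ∑ q, if q < p then siteWeight (b q) else 0

/-- The action of `E` on coordinates with respect to the basis `xvec`. -/
def raise (v : kˣ) (n : ℕ) : Module.End k ((Fin n → Fin 2) → k) where
  toFun f b := ∑ p, if b p = 0 then
    ((v ^ prefixWeight b p : kˣ) : k) * f (Function.update b p 1) else 0
  map_add' f g := by
    funext b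
    simp only [Pi.add_apply, ← Finset.sum_add_distrib]
    exact Finset.sum_congr rfl fun p _ => by split_ifs <;> ring
  map_smul' r f := by
    funext b
    simp only [Pi.smul_apply, smul_eq_mul, RingHom.id_apply, Finset.mul_sum]
    exact Finset.sum_congr rfl fun p _ => by split_ifs <;> ring

theorem raise_apply (v : kˣ) {n : ℕ} (f : (Fin n → Fin 2) → k) (b : Fin n → Fin 2) :
    raise v n f b = ∑ p, if b p = 0 then
      ((v ^ prefixWeight b p : kˣ) : k) * f (Function.update b p 1) else 0 := rfl

/-- The action of `K` on coordinates with respect to the basis `xvec`. -/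
def torus (v : kˣ) (n : ℕ) : Module.End k ((Fin n → Fin 2) → k) where
  toFun f b := ((v ^ seqWeight b : kˣ) : k) * f b
  map_add' f g := by
    funext b
    exact mul_add _ _ _
  map_smul' r f := by
    funext b
    exact mul_left_comm _ _ _

theorem torus_apply (v : kˣ) {n : ℕ} (f : (Fin n → Fin 2) → k) (b : Fin n → Fin 2) :
    torus v n f b = ((v ^ seqWeight b : kˣ) : k) * f b := rfl

/-- The part of a coordinate vector that belongs to the last tensor factor `x_j`. -/
def slice (n : ℕ) (j : Fin 2) : ((Fin (n + 1) → Fin 2) → k) →ₗ[k] ((Fin n → Fin 2) → k) :=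
  LinearMap.funLeft k k fun a => (Fin.snoc a j : Fin (n + 1) → Fin 2)

theorem slice_apply {n : ℕ} (j : Fin 2) (f : (Fin (n + 1) → Fin 2) → k) (a : Fin n → Fin 2) :
    slice n j f a = f (Fin.snoc a j : Fin (n + 1) → Fin 2) := rfl

theorem slice_ext {n : ℕ} {f g : (Fin (n + 1) → Fin 2) → k} (h0 : slice n 0 f = slice n 0 g)
    (h1 : slice n 1 f = slice n 1 g) : f = g := by
  funext b
  rw [← Fin.snoc_init_self b]
  rcases fin2_cases (b (Fin.last n)) with h | h <;> rw [h]
  · exact congrFun h0 _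
  · exact congrFun h1 _

theorem seqWeight_snoc {n : ℕ} (a : Fin n → Fin 2) (j : Fin 2) :
    seqWeight (Fin.snoc a j : Fin (n + 1) → Fin 2) = seqWeight a + siteWeight j := by
  simp [seqWeight, Fin.sum_univ_castSucc]

theorem prefixWeight_snoc_castSucc {n : ℕ} (a : Fin n → Fin 2) (j : Fin 2) (p : Fin n) :
    prefixWeight (Fin.snoc a j : Fin (n + 1) → Fin 2) p.castSucc = prefixWeight a p := by
  have : ¬ Fin.last n < p.castSucc := by simp [Fin.le_last]
  simp [prefixWeight, Fin.sum_univ_castSucc, this]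

theorem prefixWeight_snoc_last {n : ℕ} (a : Fin n → Fin 2) (j : Fin 2) :
    prefixWeight (Fin.snoc a j : Fin (n + 1) → Fin 2) (Fin.last n) = seqWeight a := by
  simp [prefixWeight, seqWeight, Fin.sum_univ_castSucc, Fin.castSucc_lt_last]

/-- `Δ(E) = E ⊗ 1 + K ⊗ E`, and `E` on the last factor only turns `x_1` into `x_0`. So the
`x_1`-slice sees `E ⊗ 1` alone, while the `x_0`-slice also receives `K` applied to the `x_1`-slice.
-/
theorem slice_one_raise (v : kˣ) {n : ℕ} (f : (Fin (n + 1) → Fin 2) → k) :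
    slice n 1 (raise v (n + 1) f) = raise v n (slice n 1 f) := by
  funext a
  simp [slice_apply, raise_apply, Fin.sum_univ_castSucc, prefixWeight_snoc_castSucc,
    Fin.snoc_update]

theorem slice_zero_raise (v : kˣ) {n : ℕ} (f : (Fin (n + 1) → Fin 2) → k) :
    slice n 0 (raise v (n + 1) f) = raise v n (slice n 0 f) + torus v n (slice n 1 f) := by
  funext a
  simp [slice_apply, raise_apply, torus_apply, Fin.sum_univ_castSucc, prefixWeight_snoc_castSucc,
    prefixWeight_snoc_last, Fin.snoc_update, Fin.update_snoc_last]

/-! ### Weight spaces in coordinates. -/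

/-- The coordinate vectors of weight `μ`. -/
def coordWeightSpace (k : Type*) [Field k] (n : ℕ) (μ : ℤ) :
    Submodule k ((Fin n → Fin 2) → k) where
  carrier := {f | ∀ b, seqWeight b ≠ μ → f b = 0}
  add_mem' hf hg b hb := by simp [hf b hb, hg b hb]
  zero_mem' _ _ := rfl
  smul_mem' r f hf b hb := by simp [hf b hb]

theorem torus_of_mem (v : kˣ) {n : ℕ} {μ : ℤ} {f : (Fin n → Fin 2) → k}
    (hf : f ∈ coordWeightSpace k n μ) : torus v n f = ((v ^ μ : kˣ) : k) • f := by
  funext b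
  by_cases h : seqWeight b = μ
  · simp [torus_apply, h]
  · simp [torus_apply, hf b h]

theorem zpow_injective_of_not_root {v : kˣ} (hv : ∀ m : ℕ, 0 < m → v ^ m ≠ 1) :
    Function.Injective fun μ : ℤ => v ^ μ :=
  injective_zpow_iff_not_isOfFinOrder.2 fun h => by
    obtain ⟨m, hm, h⟩ := isOfFinOrder_iff_pow_eq_one.1 h
    exact hv m hm h

/-- Unlike `torus_of_mem`, this direction needs distinct weights to give distinct eigenvalues of
`K`. -/
theorem mem_of_torus {v : kˣ} (hv : ∀ m : ℕ, 0 < m → v ^ m ≠ 1) {n : ℕ} {μ : ℤ}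
    {f : (Fin n → Fin 2) → k} (hf : torus v n f = ((v ^ μ : kˣ) : k) • f) :
    f ∈ coordWeightSpace k n μ := by
  intro b hb
  by_contra h
  have := congrFun hf b
  rw [torus_apply, Pi.smul_apply, smul_eq_mul] at this
  exact hb (zpow_injective_of_not_root hv (Units.ext (mul_right_cancel₀ h this)))

theorem slice_zero_mem {n : ℕ} {μ : ℤ} {f : (Fin (n + 1) → Fin 2) → k}
    (hf : f ∈ coordWeightSpace k (n + 1) μ) : slice n 0 f ∈ coordWeightSpace k n (μ - 1) :=
  fun b hb => hf _ (by rw [seqWeight_snoc, siteWeight, if_pos rfl]; omega)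

theorem slice_one_mem {n : ℕ} {μ : ℤ} {f : (Fin (n + 1) → Fin 2) → k}
    (hf : f ∈ coordWeightSpace k (n + 1) μ) : slice n 1 f ∈ coordWeightSpace k n (μ + 1) :=
  fun b hb => hf _ (by rw [seqWeight_snoc, siteWeight, if_neg (by simp)]; omega)

theorem seqWeight_update {n : ℕ} (b : Fin n → Fin 2) (p : Fin n) (t : Fin 2) :
    seqWeight (Function.update b p t) = seqWeight b + siteWeight t - siteWeight (b p) := by
  have h := Finset.sum_update_of_mem (Finset.mem_univ p) (fun q => siteWeight (b q)) (siteWeight t)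
  have h2 := Finset.sum_eq_add_sum_sdiff_singleton_of_mem (Finset.mem_univ p)
    fun q => siteWeight (b q)
  have h3 : seqWeight (Function.update b p t) =
      ∑ q, Function.update (fun q => siteWeight (b q)) p (siteWeight t) q := by
    refine Finset.sum_congr rfl fun q _ => ?_
    simp only [Function.update_apply]
    split_ifs <;> rfl
  rw [h3, h, seqWeight, h2]
  ring

theorem raise_mem (v : kˣ) {n : ℕ} {μ : ℤ} {f : (Fin n → Fin 2) → k}
    (hf : f ∈ coordWeightSpace k n μ) : raise v n f ∈ coordWeightSpace k n (μ + 2) := by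
  intro b hb
  rw [raise_apply]
  refine Finset.sum_eq_zero fun p _ => ?_
  split_ifs with h
  · rw [hf, mul_zero]
    rw [seqWeight_update, h]
    simp only [siteWeight]
    simp
    omega
  · rfl

theorem raise_pow_mem (v : kˣ) {n : ℕ} {μ : ℤ} {f : (Fin n → Fin 2) → k}
    (hf : f ∈ coordWeightSpace k n μ) (m : ℕ) :
    (raise v n ^ m) f ∈ coordWeightSpace k n (μ + 2 * m) := by
  induction m with
  | zero => simpa using hf
  | succ m ih =>
    rw [pow_succ', Module.End.mul_apply]
    have := raise_mem v ih
    push_cast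
    rwa [mul_add, ← add_assoc]

/-! ### Powers of `E` and their injectivity on negative weights. -/

theorem slice_one_raise_pow (v : kˣ) {n : ℕ} (f : (Fin (n + 1) → Fin 2) → k) (m : ℕ) :
    slice n 1 ((raise v (n + 1) ^ m) f) = (raise v n ^ m) (slice n 1 f) := by
  induction m with
  | zero => rfl
  | succ m ih => rw [pow_succ', Module.End.mul_apply, slice_one_raise, ih, pow_succ',
      Module.End.mul_apply]

/-- Each application of `E` adds one `K`-term, and `K` acts on `E ^ j f_1` by `v ^ (ν + 2 j)` since
`E` raises weights by two. -/
theorem slice_zero_raise_pow_succ (v : kˣ) {n : ℕ} {ν : ℤ} (f : (Fin (n + 1) → Fin 2) → k)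
    (hf : slice n 1 f ∈ coordWeightSpace k n ν) (m : ℕ) :
    slice n 0 ((raise v (n + 1) ^ (m + 1)) f) = (raise v n ^ (m + 1)) (slice n 0 f) +
      (∑ j ∈ Finset.range (m + 1), ((v ^ (ν + 2 * j) : kˣ) : k)) •
        (raise v n ^ m) (slice n 1 f) := by
  induction m with
  | zero => simp [slice_zero_raise, torus_of_mem v hf]
  | succ m ih =>
    rw [pow_succ', Module.End.mul_apply, slice_zero_raise, ih, slice_one_raise_pow, map_add,
      map_smul, torus_of_mem v (raise_pow_mem v hf (m + 1)), Finset.sum_range_succ _ (m + 1),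
      add_smul, ← Module.End.mul_apply, ← Module.End.mul_apply, ← pow_succ', ← pow_succ', add_assoc]

/-- Up to the unit `v ^ ν` this is a geometric sum, and multiplying it by `v ^ 2 - 1` gives `v ^ (2
(m + 1)) - 1 ≠ 0`. For `ν = -m` it is the quantum integer `[m + 1]`. -/
theorem sum_zpow_ne_zero {v : kˣ} (hv : ∀ m : ℕ, 0 < m → v ^ m ≠ 1) (ν : ℤ) (m : ℕ) :
    ∑ j ∈ Finset.range (m + 1), ((v ^ (ν + 2 * j) : kˣ) : k) ≠ 0 := by
  have h : ∑ j ∈ Finset.range (m + 1), ((v ^ (ν + 2 * j) : kˣ) : k) =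
      ((v ^ ν : kˣ) : k) * ∑ j ∈ Finset.range (m + 1), ((v : k) ^ 2) ^ j := by
    rw [Finset.mul_sum]
    refine Finset.sum_congr rfl fun j _ => ?_
    rw [zpow_add, Units.val_mul, ← pow_mul]
    norm_cast
  rw [h]
  refine mul_ne_zero (Units.ne_zero _) fun h0 => ?_
  have := geom_sum_mul ((v : k) ^ 2) (m + 1)
  rw [h0, zero_mul, ← pow_mul] at this
  refine hv (2 * (m + 1)) (by omega) (Units.ext ?_)
  push_cast
  exact (sub_eq_zero.1 this.symm)

/-- The `m`-th power of `E` is injective on the weight space of weight `-m`. -/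
theorem eq_zero_of_raise_pow_eq_zero {v : kˣ} (hv : ∀ m : ℕ, 0 < m → v ^ m ≠ 1) {n : ℕ} :
    ∀ (m : ℕ) (f : (Fin n → Fin 2) → k), f ∈ coordWeightSpace k n (-m) →
      (raise v n ^ m) f = 0 → f = 0 := by
  induction n with
  | zero =>
    intro m f hf h0
    rcases m with _ | m
    · simpa using h0
    · funext b
      refine hf b ?_
      simp [seqWeight]
      omega
  | succ n ih =>
    intro m f hf h0
    rcases m with _ | m
    · simpa using h0
    -- For `f` of weight `-(m + 1)` the slices have weights `-(m + 2)` and `-m`, so the induction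
    -- needs all exponents at once.
    have hs0 : slice n 0 f ∈ coordWeightSpace k n (-((m + 2 : ℕ) : ℤ)) := by
      convert slice_zero_mem hf using 2
      push_cast
      ring
    have hs1 : slice n 1 f ∈ coordWeightSpace k n (-(m : ℤ)) := by
      convert slice_one_mem hf using 2
      push_cast
      ring
    have e1 := slice_one_raise_pow v f (m + 1)
    have e0 := slice_zero_raise_pow_succ v f hs1 m
    rw [h0, map_zero] at e0 e1
    -- One more `E` removes the `f_1`-term, because `E ^ (m + 1) f_1 = 0`, and leaves `E ^ (m + 2)
    -- f_0 = 0`.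
    have z0 : slice n 0 f = 0 := by
      refine ih _ _ hs0 ?_
      have := congrArg (raise v n) e0
      rw [map_zero, map_add, map_smul, ← Module.End.mul_apply, ← Module.End.mul_apply,
        ← pow_succ', ← pow_succ', ← e1, smul_zero, add_zero] at this
      exact this.symm
    -- With `f_0 = 0` the other equation reads `[m + 1] E ^ m f_1 = 0`.
    have z1 : slice n 1 f = 0 := by
      refine ih _ _ hs1 ?_
      rw [z0, map_zero, zero_add] at e0
      exact (smul_eq_zero.1 e0.symm).resolve_left (sum_zpow_ne_zero hv _ _)
    exact slice_ext (by rw [z0, map_zero]) (by rw [z1, map_zero])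

/-! ### Link vectors and why they are maximal. -/

/-- The contribution of the vertex `p` of a half-diagram to a coordinate of its link vector: a link
from `i` to `j > i` becomes `(-ε) ^ j • (x_0 ⊗ x_1 - v • x_1 ⊗ x_0)`, a defect becomes `x_0`. -/
def linkWeight (v : kˣ) (ε : ℤˣ) {n : ℕ} (h : HalfDiagram n) (b : Fin n → Fin 2) (p : Fin n) : k :=
  if h.mate p = p then (if b p = 0 then 1 else 0)
  else if p < h.mate p then (if b p = b (h.mate p) then 0 else if b p = 0 then 1 else -(v : k))
  else (-((ε : ℤ) : k)) ^ (p : ℕ)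

/-- The coordinates of the highest weight vector attached to a half-diagram. -/
def linkVec (v : kˣ) (ε : ℤˣ) {n : ℕ} (h : HalfDiagram n) : (Fin n → Fin 2) → k :=
  fun b => ∏ p, linkWeight v ε h b p

theorem linkVec_eq_zero (v : kˣ) (ε : ℤˣ) {n : ℕ} {h : HalfDiagram n} {b : Fin n → Fin 2}
    {p : Fin n} (hp : linkWeight v ε h b p = 0) : linkVec v ε h b = 0 :=
  Finset.prod_eq_zero (Finset.mem_univ p) hp

theorem linkVec_eq_zero_of_defect (v : kˣ) (ε : ℤˣ) {n : ℕ} {h : HalfDiagram n}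
    {b : Fin n → Fin 2} {p : Fin n} (hp : h.mate p = p) (hb : b p ≠ 0) : linkVec v ε h b = 0 :=
  linkVec_eq_zero v ε (p := p) (by simp [linkWeight, hp, hb])

theorem linkVec_eq_zero_of_link (v : kˣ) (ε : ℤˣ) {n : ℕ} {h : HalfDiagram n}
    {b : Fin n → Fin 2} {p : Fin n} (hp : h.mate p ≠ p) (hb : b p = b (h.mate p)) :
    linkVec v ε h b = 0 := by
  rcases lt_or_gt_of_ne hp with hlt | hlt
  · exact linkVec_eq_zero v ε (p := h.mate p)
      (by simp [linkWeight, h.mate_mate, hp.symm, hlt, hb])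
  · exact linkVec_eq_zero v ε (p := p) (by simp [linkWeight, hp, hlt, hb])

theorem siteWeight_add_eq_zero {s t : Fin 2} (h : s ≠ t) : siteWeight s + siteWeight t = 0 := by
  rcases fin2_cases s with rfl | rfl <;> rcases fin2_cases t with rfl | rfl <;>
    simp_all [siteWeight]

/-- At a nonzero coordinate the ends of each link carry opposite weights and each defect carries
`x_0`, of weight one. The involution `mate` pairs off the links. -/
theorem linkVec_mem (v : kˣ) (ε : ℤˣ) {n : ℕ} (h : HalfDiagram n) :
    linkVec v ε h ∈ coordWeightSpace k n h.defects := by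
  intro b hb
  by_contra h0
  refine hb ?_
  have hs : ∑ p, (siteWeight (b p) - if h.mate p = p then 1 else 0) = 0 := by
    refine Finset.sum_involution (fun p _ => h.mate p) (fun p _ => ?_) (fun p _ hp => ?_)
      (fun _ _ => Finset.mem_univ _) fun p _ => h.mate_mate p
    · rw [h.mate_mate]
      by_cases hp : h.mate p = p
      · have : b p = 0 := by
          by_contra h1
          exact h0 (linkVec_eq_zero_of_defect v ε hp h1)
        simp [hp, this, siteWeight]
      · have : b p ≠ b (h.mate p) := fun h1 => h0 (linkVec_eq_zero_of_link v ε hp h1)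
        simp [hp, Ne.symm hp, siteWeight_add_eq_zero this]
    · intro h1
      refine hp ?_
      have : b p = 0 := by
        by_contra h2
        exact h0 (linkVec_eq_zero_of_defect v ε h1 h2)
      simp [h1, this, siteWeight]
  rw [Finset.sum_sub_distrib, sub_eq_zero] at hs
  rw [seqWeight, hs, HalfDiagram.defects]
  simp

/-- By planarity `mate` is a fixed-point-free involution of the vertices strictly under a link, and
it pairs opposite weights. -/
theorem sum_between_eq_zero {n : ℕ} (h : HalfDiagram n) (p : Fin n) (b : Fin n → Fin 2)
    (hb : ∀ r, p < r → r < h.mate p → b r ≠ b (h.mate r)) :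
    ∑ r, (if p < r ∧ r < h.mate p then siteWeight (b r) else 0) = 0 := by
  have key : ∀ r, p < r ∧ r < h.mate p → p < h.mate r ∧ h.mate r < h.mate p :=
    fun r hr => (h.planar p r hr.1 hr.2).2
  refine Finset.sum_involution (fun r _ => h.mate r) (fun r _ => ?_) (fun r _ hr => ?_)
    (fun _ _ => Finset.mem_univ _) fun r _ => h.mate_mate r
  · by_cases hr : p < r ∧ r < h.mate p
    · rw [if_pos hr, if_pos (key r hr), siteWeight_add_eq_zero (hb r hr.1 hr.2)]
    · rw [if_neg hr, if_neg fun h1 => hr (by simpa [h.mate_mate] using key _ h1), add_zero]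
  · split_ifs at hr with h1
    · exact (h.planar p r h1.1 h1.2).1
    · exact absurd rfl hr

theorem prefixWeight_mate {n : ℕ} (h : HalfDiagram n) (p : Fin n) (hp : p < h.mate p)
    (b : Fin n → Fin 2) (hb0 : b p = 0)
    (hb : ∀ r, p < r → r < h.mate p → b r ≠ b (h.mate r)) :
    prefixWeight b (h.mate p) = prefixWeight b p + 1 := by
  have h1 : prefixWeight b (h.mate p) = prefixWeight b p +
      ∑ r, ((if r = p then siteWeight (b r) else 0) +
        (if p < r ∧ r < h.mate p then siteWeight (b r) else 0)) := by
    rw [prefixWeight, prefixWeight, ← Finset.sum_add_distrib]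
    refine Finset.sum_congr rfl fun r _ => ?_
    rcases lt_trichotomy r p with hr | rfl | hr
    · simp [hr, hr.ne, hr.not_gt, hr.trans hp]
    · simp [hp]
    · simp [hr, hr.ne', hr.not_gt]
  rw [h1, Finset.sum_add_distrib, sum_between_eq_zero h p b hb]
  simp [hb0, siteWeight]

/-- The vertices strictly under the link are paired by `mate`, so there is an even number of them;
the count is made by summing `1` in `ZMod 2`. -/
theorem odd_mate_sub {n : ℕ} (h : HalfDiagram n) (p : Fin n) (hp : p < h.mate p) :
    Odd ((h.mate p : ℕ) - p) := by
  have hs : ∑ r ∈ Finset.Ioo p (h.mate p), (1 : ZMod 2) = 0 := by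
    refine Finset.sum_involution (fun r _ => h.mate r) (fun r _ => by decide) (fun r hr _ => ?_)
      (fun r hr => ?_) fun r _ => h.mate_mate r
    · rw [Finset.mem_Ioo] at hr
      exact (h.planar p r hr.1 hr.2).1
    · rw [Finset.mem_Ioo] at hr ⊢
      exact (h.planar p r hr.1 hr.2).2
  rw [Finset.sum_const, nsmul_eq_mul, mul_one, ZMod.natCast_eq_zero_iff, Fin.card_Ioo] at hs
  have : (p : ℕ) < h.mate p := hp
  rw [Nat.odd_iff]
  omega

/-- The summands at the two ends of a link cancel: the coefficient `-v` of `x_1 ⊗ x_0` meets the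
extra factor `v` which `K` collects between the ends (`prefixWeight_mate`). At a defect the summand
vanishes, since a link vector has no component with `x_1` there. -/
theorem raise_linkVec (v : kˣ) (ε : ℤˣ) {n : ℕ} (h : HalfDiagram n) :
    raise v n (linkVec v ε h) = 0 := by
  funext b
  rw [raise_apply]
  have main : ∀ p, p < h.mate p →
      (if b p = 0 then ((v ^ prefixWeight b p : kˣ) : k) *
        linkVec v ε h (Function.update b p 1) else 0) +
      (if b (h.mate p) = 0 then ((v ^ prefixWeight b (h.mate p) : kˣ) : k) *
        linkVec v ε h (Function.update b (h.mate p) 1) else 0) = 0 := by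
    intro p hp
    have hne := hp.ne
    by_cases h0 : b p = 0
    swap
    · have h1 : b p = 1 := (fin2_cases _).resolve_left h0
      rw [if_neg h0, linkVec_eq_zero_of_link v ε (p := p) hne.symm (by simp [hne, h1])]
      simp
    by_cases hm : b (h.mate p) = 0
    swap
    · have h1 : b (h.mate p) = 1 := (fin2_cases _).resolve_left hm
      rw [if_neg hm, linkVec_eq_zero_of_link v ε (p := p) hne.symm (by simp [hne.symm, h1])]
      simp
    rw [if_pos h0, if_pos hm]
    -- The two sequences differ only on this link, where they read `10` and `01`. The left end
    -- contributes `-v` and `1` respectively, the right end only its sign.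
    have e : linkVec v ε h (Function.update b p 1) =
        -(v : k) * linkVec v ε h (Function.update b (h.mate p) 1) := by
      rw [linkVec, linkVec, ← Finset.mul_prod_erase _ _ (Finset.mem_univ p),
        ← Finset.mul_prod_erase _ (fun q => linkWeight v ε h (Function.update b (h.mate p) 1) q)
          (Finset.mem_univ p), ← mul_assoc]
      congr 1
      · simp [linkWeight, hp, hne, hne.symm, h0, hm]
      · refine Finset.prod_congr rfl fun r hr => ?_
        have hr' : r ≠ p := Finset.ne_of_mem_erase hr
        by_cases hrm : r = h.mate p
        · simp [linkWeight, hrm, h.mate_mate, hne, hp.not_gt]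
        · have h1 : h.mate r ≠ p := fun e => hrm (by rw [← e, h.mate_mate])
          have h2 : h.mate r ≠ h.mate p := fun e => hr' (by rw [← h.mate_mate r, e, h.mate_mate])
          simp [linkWeight, Function.update_of_ne hr', Function.update_of_ne hrm,
            Function.update_of_ne h1, Function.update_of_ne h2]
    rw [e]
    by_cases hz : linkVec v ε h (Function.update b (h.mate p) 1) = 0
    · simp [hz]
    rw [prefixWeight_mate h p hp b h0, zpow_add]
    · push_cast
      rw [zpow_one]
      ring
    · intro r hr1 hr2 hr
      obtain ⟨h1, h2, h3⟩ := h.planar p r hr1 hr2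
      refine hz (linkVec_eq_zero_of_link v ε (p := r) h1 ?_)
      rwa [Function.update_of_ne hr2.ne, Function.update_of_ne h3.ne]
  refine Finset.sum_involution (fun p _ => h.mate p) (fun p _ => ?_) (fun p _ hp he => ?_)
    (fun _ _ => Finset.mem_univ _) fun p _ => h.mate_mate p
  · rcases lt_trichotomy p (h.mate p) with hp | hp | hp
    · exact main p hp
    · rw [← hp, linkVec_eq_zero_of_defect v ε hp.symm (by simp)]
      simp
    · have := main (h.mate p) (by rwa [h.mate_mate])
      rw [h.mate_mate] at this
      rwa [add_comm]
  · rw [linkVec_eq_zero_of_defect v ε he (by simp)] at hp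
    simp at hp

/-! ### The action of the Temperley--Lieb generators on link vectors -/

/-- The action of `e_i` on coordinates with respect to the basis `xvec`. -/
def coordGen (v : kˣ) (ε : ℤˣ) {n : ℕ} (i : Fin (n - 1)) : Module.End k ((Fin n → Fin 2) → k) where
  toFun f b := if b (posL i) = b (posR i) then 0
    else ((ε : ℤ) : k) * ((if b (posL i) = 0 then (v : k)⁻¹ else v) * f b -
      f fun p => b (Equiv.swap (posL i) (posR i) p))
  map_add' f g := by
    funext b
    simp only [Pi.add_apply]
    split_ifs <;> ring
  map_smul' r f := by
    funext b
    simp only [Pi.smul_apply, smul_eq_mul, RingHom.id_apply]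
    split_ifs <;> ring

theorem coordGen_apply (v : kˣ) (ε : ℤˣ) {n : ℕ} (i : Fin (n - 1)) (f : (Fin n → Fin 2) → k)
    (b : Fin n → Fin 2) : coordGen v ε i f b = if b (posL i) = b (posR i) then 0
      else ((ε : ℤ) : k) * ((if b (posL i) = 0 then (v : k)⁻¹ else v) * f b -
        f fun p => b (Equiv.swap (posL i) (posR i) p)) := rfl

/-- The value at `b` involves only `b` and a permutation of `b`, which has the same weight. -/
theorem coordGen_mem (v : kˣ) (ε : ℤˣ) {n : ℕ} (i : Fin (n - 1)) {μ : ℤ}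
    {f : (Fin n → Fin 2) → k} (hf : f ∈ coordWeightSpace k n μ) :
    coordGen v ε i f ∈ coordWeightSpace k n μ := by
  intro b hb
  have : seqWeight (fun p => b (Equiv.swap (posL i) (posR i) p)) = seqWeight b :=
    Equiv.sum_comp (Equiv.swap (posL i) (posR i)) fun p => siteWeight (b p)
  simp [coordGen_apply, hf b hb, hf _ (this ▸ hb)]

theorem linkVec_eq_mul (v : kˣ) (ε : ℤˣ) {n : ℕ} (h : HalfDiagram n) (b : Fin n → Fin 2)
    (S : Finset (Fin n)) {X : k} (hX : ∏ p ∈ Sᶜ, linkWeight v ε h b p = X) :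
    linkVec v ε h b = (∏ p ∈ S, linkWeight v ε h b p) * X := by
  rw [← hX, linkVec, Finset.prod_mul_prod_compl]

/-- The ends of a link have opposite parity and `ε ^ 2 = 1`. This supplies the factor `-ε` needed to
match the action of `e_i` when links are reconnected. -/
theorem sign_pow_mate (ε : ℤˣ) {n : ℕ} (h : HalfDiagram n) (p : Fin n) (hp : p < h.mate p) :
    (-((ε : ℤ) : k)) ^ (h.mate p : ℕ) = -((ε : ℤ) : k) * (-((ε : ℤ) : k)) ^ (p : ℕ) := by
  obtain ⟨m, hm⟩ := odd_mate_sub h p hp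
  have h1 : (p : ℕ) < h.mate p := hp
  have h2 : (h.mate p : ℕ) = 2 * m + 1 + p := by omega
  rw [h2, pow_add, pow_add, pow_mul, neg_sq, pow_two, sign_mul_self, one_pow, one_mul, pow_one]

/-- The reduction of the action of `e_i` on a link vector to the vertices near `i`. -/
theorem coordGen_linkVec_of_local (v : kˣ) (ε : ℤˣ) {n : ℕ} (i : Fin (n - 1)) (h : HalfDiagram n)
    (S : Finset (Fin n)) (hL : posL i ∈ S) (hR : posR i ∈ S) (hS : ∀ p ∈ S, h.mate p ∈ S)
    (hloc : ∀ b : Fin n → Fin 2, b (posL i) ≠ b (posR i) →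
      ((ε : ℤ) : k) * ((if b (posL i) = 0 then (v : k)⁻¹ else v) * (∏ p ∈ S, linkWeight v ε h b p) -
        ∏ p ∈ S, linkWeight v ε h (fun p => b (Equiv.swap (posL i) (posR i) p)) p) =
      ∏ p ∈ S, linkWeight v ε (h.stack i) b p) :
    coordGen v ε i (linkVec v ε h) = linkVec v ε (h.stack i) := by
  funext b
  have hne := posL_ne_posR i
  by_cases hb : b (posL i) = b (posR i)
  · have hm : (h.stack i).mate (posL i) = posR i := by simp [HalfDiagram.stack, stackMate]
    rw [coordGen_apply, if_pos hb, linkVec_eq_zero_of_link v ε (p := posL i) (by rw [hm]; exact hne.symm)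
      (by rw [hm, hb])]
  have hS' : ∀ p ∉ S, p ≠ posL i ∧ p ≠ posR i ∧ h.mate p ≠ posL i ∧ h.mate p ≠ posR i := by
    intro p hp
    refine ⟨fun e => hp (e ▸ hL), fun e => hp (e ▸ hR), fun e => hp ?_, fun e => hp ?_⟩
    · rw [← h.mate_mate p]
      exact hS _ (e ▸ hL)
    · rw [← h.mate_mate p]
      exact hS _ (e ▸ hR)
  -- Neither the swap nor the stacking touches the factors outside `S`, since `S` contains `i`, `i +
  -- 1` and is closed under `mate`; the three products share these factors.
  rw [coordGen_apply, if_neg hb, linkVec_eq_mul v ε h b S rfl,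
    linkVec_eq_mul v ε h (fun p => b (Equiv.swap (posL i) (posR i) p)) S
      (X := ∏ p ∈ Sᶜ, linkWeight v ε h b p),
    linkVec_eq_mul v ε (h.stack i) b S (X := ∏ p ∈ Sᶜ, linkWeight v ε h b p), ← hloc b hb]
  · ring
  · refine Finset.prod_congr rfl fun p hp => ?_
    obtain ⟨h1, h2, h3, h4⟩ := hS' p (Finset.mem_compl.1 hp)
    simp [linkWeight, HalfDiagram.stack, stackMate, h1, h2, h3, h4]
  · refine Finset.prod_congr rfl fun p hp => ?_
    obtain ⟨h1, h2, h3, h4⟩ := hS' p (Finset.mem_compl.1 hp)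
    simp [linkWeight, Equiv.swap_apply_of_ne_of_ne, h1, h2, h3, h4]

/-- The tensor `x_0 ⊗ x_1 - v x_1 ⊗ x_0` in positions `i`, `i + 1` is an eigenvector of `e_i` with
eigenvalue `δ`. -/
theorem coordGen_linkVec_of_loop (v : kˣ) (ε : ℤˣ) {n : ℕ} (i : Fin (n - 1)) (h : HalfDiagram n)
    (hm : h.mate (posL i) = posR i) :
    coordGen v ε i (linkVec v ε h) = loopValue v ε • linkVec v ε h := by
  funext b
  have hne := posL_ne_posR i
  have hm' : h.mate (posR i) = posL i := by rw [← hm, h.mate_mate]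
  have hlt : posL i < posR i := by simp [posL, posR, Fin.lt_def]
  by_cases hb : b (posL i) = b (posR i)
  · rw [coordGen_apply, if_pos hb, Pi.smul_apply, linkVec_eq_zero_of_link v ε (p := posL i)
      (by rw [hm]; exact hne.symm) (by rw [hm, hb]), smul_zero]
  rw [coordGen_apply, if_neg hb, Pi.smul_apply, linkVec_eq_mul v ε h b {posL i, posR i} rfl,
    linkVec_eq_mul v ε h (fun p => b (Equiv.swap (posL i) (posR i) p)) {posL i, posR i}
      (X := ∏ p ∈ {posL i, posR i}ᶜ, linkWeight v ε h b p), loopValue]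
  · rw [Finset.prod_pair hne, Finset.prod_pair hne]
    have hv0 := v.ne_zero
    rcases fin2_cases (b (posL i)) with h0 | h0 <;> rcases fin2_cases (b (posR i)) with h1 | h1
    · exact absurd (h0.trans h1.symm) hb
    · simp [linkWeight, hm, hm', hne, hne.symm, hlt, hlt.not_gt, h0, h1]
      ring
    · simp [linkWeight, hm, hm', hne, hne.symm, hlt, hlt.not_gt, h0, h1]
      field_simp
      ring
    · exact absurd (h0.trans h1.symm) hb
  · refine Finset.prod_congr rfl fun p hp => ?_
    have h1 : p ≠ posL i ∧ p ≠ posR i := by simpa using hp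
    have h3 : h.mate p ≠ posL i := fun e => h1.2 (by rw [← h.mate_mate p, e, hm])
    have h4 : h.mate p ≠ posR i := fun e => h1.1 (by rw [← h.mate_mate p, e, hm'])
    simp [linkWeight, Equiv.swap_apply_of_ne_of_ne, h1, h3, h4]

/-- If the entries at `i` and `i + 1` differ, both the sequence and its swap have `x_1` at a defect.
-/
theorem coordGen_linkVec_of_defects (v : kˣ) (ε : ℤˣ) {n : ℕ} (i : Fin (n - 1)) (h : HalfDiagram n)
    (hL : h.mate (posL i) = posL i) (hR : h.mate (posR i) = posR i) :
    coordGen v ε i (linkVec v ε h) = 0 := by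
  funext b
  by_cases hb : b (posL i) = b (posR i)
  · rw [coordGen_apply, if_pos hb, Pi.zero_apply]
  · rw [coordGen_apply, if_neg hb, Pi.zero_apply]
    rcases fin2_cases (b (posL i)) with h0 | h0
    · rw [linkVec_eq_zero_of_defect v ε hR fun e => hb (h0.trans e.symm),
        linkVec_eq_zero_of_defect v ε (p := posL i) hL (by
          rw [Equiv.swap_apply_left]
          exact fun e => hb (h0.trans e.symm))]
      simp
    · rw [linkVec_eq_zero_of_defect v ε hL (by simp [h0]),
        linkVec_eq_zero_of_defect v ε (p := posR i) hR (by simp [h0])]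
      simp

theorem HalfDiagram.planar_left {n : ℕ} (h : HalfDiagram n) (p q : Fin n) (h1 : h.mate p < q)
    (h2 : q < p) : h.mate q ≠ q ∧ h.mate p < h.mate q ∧ h.mate q < p := by
  simpa [h.mate_mate] using h.planar (h.mate p) q h1 (by rwa [h.mate_mate])

theorem posL_lt_posR {n : ℕ} (i : Fin (n - 1)) : posL i < posR i := by
  simp [posL, posR, Fin.lt_def]

theorem lt_posL_of_lt_posR {n : ℕ} {i : Fin (n - 1)} {p : Fin n} (h : p < posR i)
    (hne : p ≠ posL i) : p < posL i := by
  simp only [posL, posR, Fin.lt_def, ne_eq, Fin.ext_iff] at *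
  omega

theorem posR_lt_of_posL_lt {n : ℕ} {i : Fin (n - 1)} {p : Fin n} (h : posL i < p)
    (hne : p ≠ posR i) : posR i < p := by
  simp only [posL, posR, Fin.lt_def, ne_eq, Fin.ext_iff] at *
  omega

/-- No defect lies under a link, so `i + 1` is linked to the right. With `z = x_0 ⊗ x_1 - v x_1 ⊗
x_0`, the computation is `e_i (x_0 ⊗ z) = -ε z ⊗ x_0`, and the sign `(-ε) ^ mate` turns into `(-ε) ^
(i + 1)`. -/
theorem coordGen_linkVec_of_defect_left (v : kˣ) (ε : ℤˣ) {n : ℕ} (i : Fin (n - 1))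
    (h : HalfDiagram n) (hL : h.mate (posL i) = posL i) (hR : h.mate (posR i) ≠ posR i) :
    coordGen v ε i (linkVec v ε h) = linkVec v ε (h.stack i) := by
  have hLR := posL_lt_posR i
  have hmm := h.mate_mate (posR i)
  have hmL : h.mate (posR i) ≠ posL i := fun e => hLR.ne (by rw [← hmm, e, hL])
  have hm : posR i < h.mate (posR i) := (lt_or_gt_of_ne hR).resolve_left fun hlt =>
    (h.planar_left (posR i) (posL i) (lt_posL_of_lt_posR hlt hmL) hLR).1 hL
  have hσ := sign_pow_mate (k := k) ε h (posR i) hm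
  have hLm := hLR.trans hm
  refine coordGen_linkVec_of_local v ε i h {posL i, posR i, h.mate (posR i)} (by simp) (by simp)
    (by simp [hL, hmm]) fun b hb => ?_
  rw [Finset.prod_insert (by simp [hLR.ne, hmL.symm]), Finset.prod_pair hm.ne,
    Finset.prod_insert (by simp [hLR.ne, hmL.symm]), Finset.prod_pair hm.ne,
    Finset.prod_insert (by simp [hLR.ne, hmL.symm]), Finset.prod_pair hm.ne]
  have hs := sign_mul_self k ε
  have hv := v.ne_zero
  simp only [linkWeight, HalfDiagram.stack, stackMate, hL, hmm, hLR, hLR.ne, hLR.ne', hLR.not_gt,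
    hm, hm.ne, hm.ne', hm.not_gt, hLm.ne', if_true, if_false, hσ,
    Equiv.swap_apply_left, Equiv.swap_apply_right, Equiv.swap_apply_of_ne_of_ne hmL hR]
  generalize (-((ε : ℤ) : k)) ^ (posR i : ℕ) = A
  generalize ((ε : ℤ) : k) = s at *
  rcases fin2_cases (b (posL i)) with h0 | h0 <;> rcases fin2_cases (b (posR i)) with h1 | h1 <;>
    rcases fin2_cases (b (h.mate (posR i))) with h2 | h2 <;>
    simp [h0, h1, h2, hv] at hb ⊢ <;> grind

/-- The mirror image: `i` is linked to the left and `e_i (z ⊗ x_0) = -ε x_0 ⊗ z`, the right end of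
the link moving from `i` to `i + 1`. -/
theorem coordGen_linkVec_of_defect_right (v : kˣ) (ε : ℤˣ) {n : ℕ} (i : Fin (n - 1))
    (h : HalfDiagram n) (hL : h.mate (posL i) ≠ posL i) (hR : h.mate (posR i) = posR i) :
    coordGen v ε i (linkVec v ε h) = linkVec v ε (h.stack i) := by
  have hLR := posL_lt_posR i
  have hmm := h.mate_mate (posL i)
  have hmR : h.mate (posL i) ≠ posR i := fun e => hLR.ne (by rw [← hmm, e, hR])
  have hm : h.mate (posL i) < posL i := (lt_or_gt_of_ne hL).resolve_right fun hlt =>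
    (h.planar (posL i) (posR i) hLR (posR_lt_of_posL_lt hlt hmR)).1 hR
  have hσ := sign_pow_mate (k := k) ε h (h.mate (posL i)) (by rwa [hmm])
  rw [hmm] at hσ
  have hmR' := hm.trans hLR
  refine coordGen_linkVec_of_local v ε i h {h.mate (posL i), posL i, posR i} (by simp) (by simp)
    (by simp [hR, hmm]) fun b hb => ?_
  rw [Finset.prod_insert (by simp [hm.ne, hmR]), Finset.prod_pair hLR.ne,
    Finset.prod_insert (by simp [hm.ne, hmR]), Finset.prod_pair hLR.ne,
    Finset.prod_insert (by simp [hm.ne, hmR]), Finset.prod_pair hLR.ne]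
  have hs := sign_mul_self k ε
  have hv := v.ne_zero
  have hR1 : (posR i : ℕ) = posL i + 1 := rfl
  simp only [linkWeight, HalfDiagram.stack, stackMate, hR, hmm, hLR, hLR.ne, hLR.ne', hLR.not_gt,
    hm, hm.ne, hm.ne', hm.not_gt, hmR'.ne, if_true, if_false, hR1,
    pow_succ, hσ,
    Equiv.swap_apply_left, Equiv.swap_apply_right, Equiv.swap_apply_of_ne_of_ne hL hmR]
  generalize (-((ε : ℤ) : k)) ^ (h.mate (posL i) : ℕ) = A
  generalize ((ε : ℤ) : k) = s at *
  rcases fin2_cases (b (posL i)) with h0 | h0 <;> rcases fin2_cases (b (posR i)) with h1 | h1 <;>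
    rcases fin2_cases (b (h.mate (posL i))) with h2 | h2 <;>
    simp [h0, h1, h2] at hb ⊢ <;> grind

/-- The links at `i` and `i + 1` go both left (nested), left and right, or both right (nested). The
order of the two mates decides which is the left end of the new link. What remains is a check of the
possible entries at the four vertices. -/
theorem coordGen_linkVec_of_links (v : kˣ) (ε : ℤˣ) {n : ℕ} (i : Fin (n - 1))
    (h : HalfDiagram n) (hL : h.mate (posL i) ≠ posL i) (hR : h.mate (posR i) ≠ posR i)
    (hl : h.mate (posL i) ≠ posR i) :
    coordGen v ε i (linkVec v ε h) = linkVec v ε (h.stack i) := by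
  have hLR := posL_lt_posR i
  have hmL := h.mate_mate (posL i)
  have hmR := h.mate_mate (posR i)
  have hr : h.mate (posR i) ≠ posL i := fun e => hl (by rw [← e, hmR])
  have hlr : h.mate (posL i) ≠ h.mate (posR i) := fun e => hLR.ne (by rw [← hmL, e, hmR])
  have hR1 : (posR i : ℕ) = posL i + 1 := rfl
  have hs := sign_mul_self k ε
  have hv := v.ne_zero
  have n1 : posL i ∉ ({posR i, h.mate (posL i), h.mate (posR i)} : Finset (Fin n)) := by
    simp [hLR.ne, hL.symm, hr.symm]
  have n2 : posR i ∉ ({h.mate (posL i), h.mate (posR i)} : Finset (Fin n)) := by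
    simp [hl.symm, hR.symm]
  refine coordGen_linkVec_of_local v ε i h {posL i, posR i, h.mate (posL i), h.mate (posR i)}
    (by simp) (by simp) (by simp [hmL, hmR]) fun b hb => ?_
  simp only [Finset.prod_insert n1, Finset.prod_insert n2, Finset.prod_pair hlr]
  rcases lt_or_gt_of_ne hL with h1 | h1 <;> rcases lt_or_gt_of_ne hR with h2 | h2
  · have h2' := lt_posL_of_lt_posR h2 hr
    have h3 := (h.planar_left (posR i) (posL i) h2' hLR).2.1
    have hσ := sign_pow_mate (k := k) ε h (h.mate (posL i)) (by rwa [hmL])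
    rw [hmL] at hσ
    simp only [linkWeight, HalfDiagram.stack, stackMate, hmL, hmR, hLR, hLR.ne, hLR.ne', hLR.not_gt,
      hL, hR, hl, hr, hlr, hL.symm, hR.symm, hlr.symm, h1, h1.not_gt,
      h2, h2.not_gt, h3, h3.not_gt, if_true, if_false, hR1, pow_succ,
      hσ, Equiv.swap_apply_left, Equiv.swap_apply_right, Equiv.swap_apply_of_ne_of_ne hL hl,
      Equiv.swap_apply_of_ne_of_ne hr hR]
    generalize (-((ε : ℤ) : k)) ^ (h.mate (posL i) : ℕ) = A
    generalize ((ε : ℤ) : k) = s at *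
    rcases fin2_cases (b (posL i)) with h4 | h4 <;>
      rcases fin2_cases (b (posR i)) with h5 | h5 <;>
      rcases fin2_cases (b (h.mate (posL i))) with h6 | h6 <;>
      rcases fin2_cases (b (h.mate (posR i))) with h7 | h7 <;>
      simp [h4, h5, h6, h7] at hb ⊢ <;> grind
  · have h3 := (h1.trans hLR).trans h2
    have hσ := sign_pow_mate (k := k) ε h (posR i) h2
    simp only [linkWeight, HalfDiagram.stack, stackMate, hmL, hmR, hLR, hLR.ne, hLR.ne', hLR.not_gt,
      hL, hR, hl, hr, hlr, hL.symm, hR.symm, hlr.symm, h1, h1.not_gt,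
      h2, h2.not_gt, h3, h3.not_gt, if_true, if_false, hσ, hR1,
      pow_succ, Equiv.swap_apply_left, Equiv.swap_apply_right, Equiv.swap_apply_of_ne_of_ne hL hl,
      Equiv.swap_apply_of_ne_of_ne hr hR]
    generalize (-((ε : ℤ) : k)) ^ (posL i : ℕ) = A
    generalize ((ε : ℤ) : k) = s at *
    rcases fin2_cases (b (posL i)) with h4 | h4 <;>
      rcases fin2_cases (b (posR i)) with h5 | h5 <;>
      rcases fin2_cases (b (h.mate (posL i))) with h6 | h6 <;>
      rcases fin2_cases (b (h.mate (posR i))) with h7 | h7 <;>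
      simp [h4, h5, h6, h7] at hb ⊢ <;> grind
  -- Here `i` would be linked to the right and `i + 1` to the left, so the links would cross.
  · have h1' := posR_lt_of_posL_lt h1 hl
    exact absurd (lt_posL_of_lt_posR h2 hr) (h.planar (posL i) (posR i) hLR h1').2.1.not_gt
  · have h1' := posR_lt_of_posL_lt h1 hl
    have h3 := (h.planar (posL i) (posR i) hLR h1').2.2
    have hσ := sign_pow_mate (k := k) ε h (posR i) h2
    simp only [linkWeight, HalfDiagram.stack, stackMate, hmL, hmR, hLR, hLR.ne, hLR.ne', hLR.not_gt,
      hL, hR, hl, hr, hlr, hL.symm, hR.symm, hlr.symm, h1, h1.not_gt,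
      h2, h2.not_gt, h3, h3.not_gt, if_true, if_false, hσ,
      Equiv.swap_apply_left, Equiv.swap_apply_right, Equiv.swap_apply_of_ne_of_ne hL hl,
      Equiv.swap_apply_of_ne_of_ne hr hR]
    generalize (-((ε : ℤ) : k)) ^ (posR i : ℕ) = A
    generalize (-((ε : ℤ) : k)) ^ (h.mate (posL i) : ℕ) = B
    generalize ((ε : ℤ) : k) = s at *
    rcases fin2_cases (b (posL i)) with h4 | h4 <;>
      rcases fin2_cases (b (posR i)) with h5 | h5 <;>
      rcases fin2_cases (b (h.mate (posL i))) with h6 | h6 <;>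
      rcases fin2_cases (b (h.mate (posR i))) with h7 | h7 <;>
      simp [h4, h5, h6, h7] at hb ⊢ <;> grind

theorem HalfDiagram.stack_eq_self {n : ℕ} (i : Fin (n - 1)) (h : HalfDiagram n)
    (hm : h.mate (posL i) = posR i) : h.stack i = h := by
  have hmm := h.mate_mate
  have hne := posL_ne_posR i
  ext1
  funext j
  simp only [stack]
  unfold stackMate
  grind

theorem coordGen_linkVec (v : kˣ) (ε : ℤˣ) {n : ℕ} (i : Fin (n - 1)) (h : HalfDiagram n)
    (hd : ¬(h.mate (posL i) = posL i ∧ h.mate (posR i) = posR i)) :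
    coordGen v ε i (linkVec v ε h) = loopValue v ε ^ h.loops i • linkVec v ε (h.stack i) := by
  by_cases hl : h.mate (posL i) = posR i
  · rw [HalfDiagram.loops, if_pos hl, pow_one, HalfDiagram.stack_eq_self i h hl,
      coordGen_linkVec_of_loop v ε i h hl]
  rw [HalfDiagram.loops, if_neg hl, pow_zero, one_smul]
  by_cases hL : h.mate (posL i) = posL i
  · exact coordGen_linkVec_of_defect_left v ε i h hL fun hR => hd ⟨hL, hR⟩
  by_cases hR : h.mate (posR i) = posR i
  · exact coordGen_linkVec_of_defect_right v ε i h hL hR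
  · exact coordGen_linkVec_of_links v ε i h hL hR hl

/-! ### Removing and adding the last vertex of a half-diagram -/

/-- Remove the last vertex; the vertex linked to it becomes a defect. -/
def HalfDiagram.restrict {n : ℕ} (h : HalfDiagram (n + 1)) : HalfDiagram n where
  mate q := if hq : h.mate q.castSucc = Fin.last n then q else (h.mate q.castSucc).castPred hq
  mate_mate q := by
    by_cases hq : h.mate q.castSucc = Fin.last n
    · simp [hq]
    · simp [hq, h.mate_mate]
  planar i j hij hj := by
    by_cases hi : h.mate i.castSucc = Fin.last n
    · rw [dif_pos hi] at hj
      exact absurd hj hij.not_gt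
    · rw [dif_neg hi, Fin.lt_castPred_iff] at hj
      obtain ⟨h1, h2, h3⟩ := h.planar i.castSucc j.castSucc hij hj
      have h4 : h.mate j.castSucc ≠ Fin.last n := (h3.trans_le (Fin.le_last _)).ne
      rw [dif_neg hi, dif_neg h4]
      refine ⟨fun e => h1 ?_, ?_, ?_⟩
      · rw [← Fin.castSucc_inj, Fin.castSucc_castPred] at e
        exact e
      · rwa [Fin.lt_castPred_iff]
      · rwa [Fin.castPred_lt_castPred_iff]

theorem HalfDiagram.castSucc_restrict_mate {n : ℕ} (h : HalfDiagram (n + 1)) (q : Fin n) :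
    (h.restrict.mate q).castSucc =
      if h.mate q.castSucc = Fin.last n then q.castSucc else h.mate q.castSucc := by
  simp only [restrict]
  split_ifs <;> simp

/-- Add a defect as the last vertex. -/
def HalfDiagram.addDefect {n : ℕ} (h : HalfDiagram n) : HalfDiagram (n + 1) where
  mate := Fin.lastCases (Fin.last n) fun q => (h.mate q).castSucc
  mate_mate q := by
    cases q using Fin.lastCases <;> simp [h.mate_mate]
  planar i j hij hj := by
    cases i using Fin.lastCases with
    | last => exact absurd hij (Fin.le_last _).not_gt
    | cast i =>
      cases j using Fin.lastCases with
      | last => exact absurd hj (Fin.le_last _).not_gt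
      | cast j =>
        simp only [Fin.lastCases_castSucc, Fin.castSucc_lt_castSucc_iff, ne_eq,
          Fin.castSucc_inj] at hij hj ⊢
        exact h.planar i j hij hj

/-- Add a last vertex and link it to the last defect `p`. -/
def HalfDiagram.addLink {n : ℕ} (h : HalfDiagram n) (p : Fin n) (hp : h.mate p = p)
    (hlast : ∀ q, p < q → h.mate q ≠ q) : HalfDiagram (n + 1) where
  mate := Fin.lastCases p.castSucc fun q => if q = p then Fin.last n else (h.mate q).castSucc
  mate_mate q := by
    cases q using Fin.lastCases with
    | last => simp
    | cast q =>
      by_cases hq : q = p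
      · simp [hq]
      · have : h.mate q ≠ p := fun e => hq (by rw [← h.mate_mate q, e, hp])
        simp [hq, this, h.mate_mate]
  planar i j hij hj := by
    cases i using Fin.lastCases with
    | last => exact absurd hij (Fin.le_last _).not_gt
    | cast i =>
      cases j using Fin.lastCases with
      | last => exact absurd hj (Fin.le_last _).not_gt
      | cast j =>
        simp only [Fin.lastCases_castSucc, Fin.castSucc_lt_castSucc_iff] at hij hj ⊢
        by_cases hi : i = p
        · subst hi
          have hji : h.mate j ≠ i := fun e => hij.ne' (by rw [← h.mate_mate j, e, hp])
          have h1 := hlast j hij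
          simp only [hij.ne', if_false, if_true, ne_eq, Fin.castSucc_inj, h1, not_false_eq_true,
            Fin.castSucc_lt_castSucc_iff, Fin.castSucc_lt_last, and_true, true_and]
          refine (lt_or_gt_of_ne hji).resolve_left fun hlt => ?_
          exact (h.planar_left j i hlt hij).1 hp
        · rw [if_neg hi, Fin.castSucc_lt_castSucc_iff] at hj
          obtain ⟨h1, h2, h3⟩ := h.planar i j hij hj
          have : j ≠ p := fun e => h1 (by rw [e, hp])
          simp [hi, this, h1, h2, h3]

theorem HalfDiagram.restrict_addDefect {n : ℕ} (h : HalfDiagram n) :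
    h.addDefect.restrict = h := by
  ext1
  funext q
  rw [← Fin.castSucc_inj, castSucc_restrict_mate]
  simp [addDefect]

theorem HalfDiagram.restrict_addLink {n : ℕ} (h : HalfDiagram n) (p : Fin n) (hp : h.mate p = p)
    (hlast : ∀ q, p < q → h.mate q ≠ q) : (h.addLink p hp hlast).restrict = h := by
  ext1
  funext q
  rw [← Fin.castSucc_inj, castSucc_restrict_mate]
  by_cases hq : q = p
  · simp [addLink, hq, hp]
  · simp [addLink, hq]

theorem HalfDiagram.exists_last_defect {n : ℕ} (h : HalfDiagram n) (hd : 0 < h.defects) :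
    ∃ p, h.mate p = p ∧ ∀ q, p < q → h.mate q ≠ q := by
  have hne := Finset.card_pos.1 hd
  refine ⟨Finset.max' _ hne, by simpa using Finset.max'_mem _ hne, fun q hq e => ?_⟩
  exact hq.not_ge (Finset.le_max' _ q (by simpa using e))

/-- The vertex linked to the last vertex is the last defect of the restriction. -/
theorem HalfDiagram.restrict_last_defect {n : ℕ} (h : HalfDiagram (n + 1)) (p : Fin n)
    (hp : h.mate (Fin.last n) = p.castSucc) :
    h.restrict.mate p = p ∧ ∀ q, p < q → h.restrict.mate q ≠ q := by
  have hp' : h.mate p.castSucc = Fin.last n := by rw [← hp, h.mate_mate]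
  constructor
  · rw [← Fin.castSucc_inj, castSucc_restrict_mate, if_pos hp']
  · intro q hq
    obtain ⟨h1, -, h3⟩ := h.planar p.castSucc q.castSucc hq (hp' ▸ Fin.castSucc_lt_last q)
    rw [hp'] at h3
    rwa [ne_eq, ← Fin.castSucc_inj, castSucc_restrict_mate, if_neg h3.ne]

theorem HalfDiagram.ext_of_restrict {n : ℕ} {g h : HalfDiagram (n + 1)}
    (he : g.restrict = h.restrict) (hl : g.mate (Fin.last n) = h.mate (Fin.last n)) : g = h := by
  ext1
  funext q
  cases q using Fin.lastCases with
  | last => exact hl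
  | cast q =>
    have e := congrArg (fun f : HalfDiagram n => (f.mate q).castSucc) he
    simp only [castSucc_restrict_mate] at e
    have h0 : ∀ f : HalfDiagram (n + 1),
        f.mate q.castSucc = Fin.last n ↔ f.mate (Fin.last n) = q.castSucc := fun f =>
      ⟨fun e => by rw [← e, f.mate_mate], fun e => by rw [← e, f.mate_mate]⟩
    have h1 : g.mate q.castSucc = Fin.last n ↔ h.mate q.castSucc = Fin.last n := by
      rw [h0, h0, hl]
    by_cases h2 : g.mate q.castSucc = Fin.last n
    · rw [h2, h1.1 h2]
    · rwa [if_neg h2, if_neg (h1.not.1 h2)] at e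

/-- The former partner of the removed vertex can be recovered as the last defect of the restriction.
-/
theorem HalfDiagram.restrict_injOn_links {n : ℕ} {g h : HalfDiagram (n + 1)}
    (he : g.restrict = h.restrict) (hg : g.mate (Fin.last n) ≠ Fin.last n)
    (hh : h.mate (Fin.last n) ≠ Fin.last n) : g = h := by
  refine ext_of_restrict he ?_
  obtain ⟨p, hp⟩ := Fin.exists_castSucc_eq.2 hg
  obtain ⟨q, hq⟩ := Fin.exists_castSucc_eq.2 hh
  obtain ⟨h1, h2⟩ := g.restrict_last_defect p hp.symm
  obtain ⟨h3, h4⟩ := h.restrict_last_defect q hq.symm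
  rw [he] at h1 h2
  rw [← hp, ← hq]
  rcases lt_trichotomy p q with h5 | h5 | h5
  · exact absurd h3 (h2 q h5)
  · rw [h5]
  · exact absurd h1 (h4 p h5)

theorem HalfDiagram.defects_restrict {n : ℕ} (h : HalfDiagram (n + 1)) :
    (h.restrict.defects : ℤ) =
      if h.mate (Fin.last n) = Fin.last n then (h.defects : ℤ) - 1 else h.defects + 1 := by
  have h1 : ∀ q, (if h.restrict.mate q = q then 1 else 0 : ℤ) =
      (if h.mate q.castSucc = q.castSucc then 1 else 0) +
        if h.mate (Fin.last n) = q.castSucc then 1 else 0 := by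
    intro q
    have h2 : h.mate (Fin.last n) = q.castSucc ↔ h.mate q.castSucc = Fin.last n :=
      ⟨fun e => by rw [← e, h.mate_mate], fun e => by rw [← e, h.mate_mate]⟩
    have h4 : h.restrict.mate q = q ↔
        (if h.mate q.castSucc = Fin.last n then q.castSucc else h.mate q.castSucc) = q.castSucc := by
      rw [← castSucc_restrict_mate, Fin.castSucc_inj]
    simp only [h4]
    by_cases h3 : h.mate q.castSucc = Fin.last n
    · simp [h2, h3, (Fin.castSucc_lt_last q).ne']
    · simp [h2, h3]
  have h4 : (h.defects : ℤ) = ∑ q, if h.mate q = q then 1 else 0 := by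
    rw [defects, Finset.card_filter]
    push_cast
    rfl
  have h5 : (h.restrict.defects : ℤ) = ∑ q, if h.restrict.mate q = q then 1 else 0 := by
    rw [defects, Finset.card_filter]
    push_cast
    rfl
  rw [h4, h5, Fin.sum_univ_castSucc, Finset.sum_congr rfl fun q _ => h1 q, Finset.sum_add_distrib]
  split_ifs with h6
  · simp [h6, (Fin.castSucc_lt_last _).ne']
  · obtain ⟨p, hp⟩ := Fin.exists_castSucc_eq.2 h6
    simp [← hp]

/-! ### Slices of link vectors -/

theorem slice_linkVec_of_defect (v : kˣ) (ε : ℤˣ) {n : ℕ} (h : HalfDiagram (n + 1))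
    (hl : h.mate (Fin.last n) = Fin.last n) (j : Fin 2) :
    slice n j (linkVec v ε h) = if j = 0 then linkVec v ε h.restrict else 0 := by
  funext a
  rw [slice_apply]
  split_ifs with hj
  · rw [linkVec, Fin.prod_univ_castSucc, linkVec]
    rw [linkWeight, if_pos hl, Fin.snoc_last, if_pos hj, mul_one]
    refine Finset.prod_congr rfl fun q _ => ?_
    have h1 : h.mate q.castSucc ≠ Fin.last n := fun e =>
      (Fin.castSucc_lt_last q).ne (by rw [← h.mate_mate q.castSucc, e, hl])
    have h2 : (h.restrict.mate q).castSucc = h.mate q.castSucc := by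
      rw [h.castSucc_restrict_mate, if_neg h1]
    simp only [linkWeight, ← h2, Fin.castSucc_inj, Fin.castSucc_lt_castSucc_iff, Fin.snoc_castSucc,
      Fin.val_castSucc]
  · exact linkVec_eq_zero_of_defect v ε hl (by simpa using hj)

/-- With `x_1` at the right end `n` of the link, the left end must carry `x_0`, with coefficient
one. This is the factor of a defect, which that vertex becomes in the restriction. -/
theorem slice_one_linkVec_of_link (v : kˣ) (ε : ℤˣ) {n : ℕ} (h : HalfDiagram (n + 1))
    (hl : h.mate (Fin.last n) ≠ Fin.last n) :
    slice n 1 (linkVec v ε h) = (-((ε : ℤ) : k)) ^ n • linkVec v ε h.restrict := by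
  funext a
  rw [slice_apply, linkVec, Fin.prod_univ_castSucc, Pi.smul_apply, smul_eq_mul, mul_comm, linkVec]
  congr 1
  · simp [linkWeight, hl, (Fin.le_last _).not_gt]
  · refine Finset.prod_congr rfl fun q _ => ?_
    by_cases hq : h.mate q.castSucc = Fin.last n
    · have h2 : h.restrict.mate q = q := by
        rw [← Fin.castSucc_inj, h.castSucc_restrict_mate, if_pos hq]
      rcases fin2_cases (a q) with h3 | h3 <;>
        simp [linkWeight, hq, h2, (Fin.castSucc_lt_last q).ne', Fin.castSucc_lt_last, h3]
    · have h2 : (h.restrict.mate q).castSucc = h.mate q.castSucc := by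
        rw [h.castSucc_restrict_mate, if_neg hq]
      simp only [linkWeight, ← h2, Fin.castSucc_inj, Fin.castSucc_lt_castSucc_iff,
        Fin.snoc_castSucc, Fin.val_castSucc]

/-! ### Link vectors are a basis of the maximal vectors. -/

theorem sign_pow_ne_zero (ε : ℤˣ) (m : ℕ) : (-((ε : ℤ) : k)) ^ m ≠ 0 :=
  pow_ne_zero _ (neg_ne_zero.2 (left_ne_zero_of_mul_eq_one (sign_mul_self k ε)))

/-- The `x_1`-slice kills the diagrams whose last vertex is a defect and is injective on the others,
so it isolates the coefficients of the latter. Once these vanish, the `x_0`-slice treats the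
remaining diagrams. -/
theorem linearIndependent_linkVec (v : kˣ) (ε : ℤˣ) (n : ℕ) :
    LinearIndependent k (linkVec v ε : HalfDiagram n → (Fin n → Fin 2) → k) := by
  induction n with
  | zero =>
    have : Subsingleton (HalfDiagram 0) := ⟨fun g h => by
      ext1
      exact Subsingleton.elim _ _⟩
    rw [linearIndependent_subsingleton_index_iff]
    intro h h0
    have := congrFun h0 Fin.elim0
    simp [linkVec] at this
  | succ n ih =>
    classical
    have hlink : LinearIndependent k fun h : {h : HalfDiagram (n + 1) //
        h.mate (Fin.last n) ≠ Fin.last n} => linkVec (k := k) v ε h.1.restrict :=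
      ih.comp (fun h : {h : HalfDiagram (n + 1) // h.mate (Fin.last n) ≠ Fin.last n} =>
        h.1.restrict) fun g h e => Subtype.ext (HalfDiagram.restrict_injOn_links e g.2 h.2)
    have hdef : LinearIndependent k fun h : {h : HalfDiagram (n + 1) //
        h.mate (Fin.last n) = Fin.last n} => linkVec (k := k) v ε h.1.restrict :=
      ih.comp (fun h : {h : HalfDiagram (n + 1) // h.mate (Fin.last n) = Fin.last n} =>
        h.1.restrict) fun g h e => Subtype.ext (HalfDiagram.ext_of_restrict e (g.2.trans h.2.symm))
    rw [linearIndependent_iff']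
    intro s g hg
    have h1 : ∀ h ∈ s, h.mate (Fin.last n) ≠ Fin.last n → g h = 0 := by
      have e := congrArg (slice n 1) hg
      rw [map_sum, map_zero, ← Finset.sum_filter_add_sum_filter_not s
        fun h => h.mate (Fin.last n) ≠ Fin.last n, add_eq_left.2, ← Finset.sum_subtype_eq_sum_filter] at e
      · have e2 : ∑ h ∈ s.subtype fun h => h.mate (Fin.last n) ≠ Fin.last n,
            (g h * (-((ε : ℤ) : k)) ^ n) • linkVec v ε h.1.restrict = 0 := by
          rw [← e]
          refine Finset.sum_congr rfl fun h _ => ?_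
          rw [map_smul, slice_one_linkVec_of_link v ε h.1 h.2, smul_smul]
        intro h hs hh
        exact (mul_eq_zero.1 (linearIndependent_iff'.1 hlink _ (fun h => g h.1 * _) e2 ⟨h, hh⟩
          (by simpa using hs))).resolve_right (sign_pow_ne_zero ε n)
      · refine Finset.sum_eq_zero fun h hh => ?_
        have := (Finset.mem_filter.1 hh).2
        rw [map_smul, slice_linkVec_of_defect v ε h (not_not.1 this), if_neg (by simp), smul_zero]
    have h2 : ∀ h ∈ s, h.mate (Fin.last n) = Fin.last n → g h = 0 := by
      have e := congrArg (slice n 0) hg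
      rw [map_sum, map_zero, ← Finset.sum_filter_add_sum_filter_not s
        fun h => h.mate (Fin.last n) = Fin.last n, add_eq_left.2, ← Finset.sum_subtype_eq_sum_filter] at e
      · have e2 : ∑ h ∈ s.subtype fun h => h.mate (Fin.last n) = Fin.last n,
            g h • linkVec v ε h.1.restrict = 0 := by
          rw [← e]
          refine Finset.sum_congr rfl fun h _ => ?_
          rw [map_smul, slice_linkVec_of_defect v ε h.1 h.2, if_pos rfl]
        intro h hs hh
        exact linearIndependent_iff'.1 hdef _ (fun h => g h.1) e2 ⟨h, hh⟩ (by simpa using hs)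
      · refine Finset.sum_eq_zero fun h hh => ?_
        have := Finset.mem_filter.1 hh
        rw [h1 h this.1 this.2, zero_smul, map_zero]
    intro h hs
    by_cases hh : h.mate (Fin.last n) = Fin.last n
    · exact h2 h hs hh
    · exact h1 h hs hh

/-- The link vectors with `l` defects span the kernel of `E` on the vectors of weight `l`. -/
theorem mem_span_linkVec {v : kˣ} (hv : ∀ m : ℕ, 0 < m → v ^ m ≠ 1) (ε : ℤˣ) (n : ℕ) :
    ∀ (l : ℕ) (f : (Fin n → Fin 2) → k), f ∈ coordWeightSpace k n l → raise v n f = 0 →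
      f ∈ Submodule.span k (linkVec v ε '' {h : HalfDiagram n | h.defects = l}) := by
  induction n with
  | zero =>
    intro l f hf _
    rcases Nat.eq_zero_or_pos l with rfl | hl
    · let h : HalfDiagram 0 := ⟨Fin.elim0, fun i => i.elim0, fun i => i.elim0⟩
      have : f = f Fin.elim0 • linkVec v ε h := by
        funext b
        rw [Subsingleton.elim b Fin.elim0]
        simp [linkVec]
      rw [this]
      exact Submodule.smul_mem _ _ (Submodule.subset_span ⟨h, by simp [HalfDiagram.defects], rfl⟩)
    · have : f = 0 := by
        funext b
        refine hf b ?_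
        simp [seqWeight]
        omega
      rw [this]
      exact Submodule.zero_mem _
  | succ n ih =>
    intro l f hf h0
    have e1 := slice_one_raise v f
    rw [h0, map_zero] at e1
    have m1 := ih (l + 1) (slice n 1 f) (by exact_mod_cast slice_one_mem hf) e1.symm
    -- A diagram with `l + 1` defects has a last defect; linking it to a new last vertex leaves `l`
    -- defects and lifts the link vector along the `x_1`-slice, up to sign.
    have hsub : Submodule.span k (linkVec v ε '' {h : HalfDiagram n | h.defects = l + 1}) ≤
        (Submodule.span k (linkVec v ε '' {h : HalfDiagram (n + 1) | h.defects = l})).map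
          (slice n 1) := by
      rw [Submodule.span_le]
      rintro _ ⟨h, hh, rfl⟩
      obtain ⟨p, hp, hlast⟩ := h.exists_last_defect (by rw [hh]; omega)
      have hl : (h.addLink p hp hlast).mate (Fin.last n) ≠ Fin.last n := by
        simp [HalfDiagram.addLink, (Fin.castSucc_lt_last p).ne]
      have hd := (h.addLink p hp hlast).defects_restrict
      rw [if_neg hl, h.restrict_addLink, hh] at hd
      refine ⟨((-((ε : ℤ) : k)) ^ n)⁻¹ • linkVec v ε (h.addLink p hp hlast),
        Submodule.smul_mem _ _ (Submodule.subset_span ⟨_, ?_, rfl⟩), ?_⟩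
      · simp only [Set.mem_ofPred_eq]
        omega
      · rw [map_smul, slice_one_linkVec_of_link v ε _ hl, h.restrict_addLink,
          inv_smul_smul₀ (sign_pow_ne_zero ε n)]
    obtain ⟨g, hg, hgf⟩ := hsub m1
    have hgW : g ∈ coordWeightSpace k (n + 1) l ⊓ LinearMap.ker (raise v (n + 1)) := by
      refine Submodule.span_le.2 ?_ hg
      rintro _ ⟨h, hh, rfl⟩
      exact ⟨hh ▸ linkVec_mem v ε h, raise_linkVec v ε h⟩
    -- After subtracting `g` no `K`-term is left in the `x_0`-slice of `E (f - g)`, so that slice of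
    -- `f - g` is itself killed by `E`.
    have hd1 : slice n 1 (f - g) = 0 := by rw [map_sub, hgf, sub_self]
    have hdW : slice n 0 (f - g) ∈ coordWeightSpace k n (l - 1) :=
      slice_zero_mem (Submodule.sub_mem _ hf hgW.1)
    have hdE : raise v n (slice n 0 (f - g)) = 0 := by
      have := slice_zero_raise v (f - g)
      rw [map_sub (raise v (n + 1)), h0, LinearMap.mem_ker.1 hgW.2, sub_self, map_zero, hd1,
        map_zero, add_zero] at this
      exact this.symm
    suffices f - g ∈ Submodule.span k (linkVec v ε '' {h : HalfDiagram (n + 1) | h.defects = l}) by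
      simpa using Submodule.add_mem _ this hg
    rcases l with _ | l
    -- The slice has weight `-1`, where `E` is injective.
    · have : slice n 0 (f - g) = 0 :=
        eq_zero_of_raise_pow_eq_zero hv 1 _ (by simpa using hdW) (by rwa [pow_one])
      rw [slice_ext (f := f - g) (g := 0) (by rw [this, map_zero]) (by rw [hd1, map_zero])]
      exact Submodule.zero_mem _
    · have m0 := ih l _ (by simpa using hdW) hdE
      -- Adding a defect lifts along the `x_0`-slice. The lifts have zero `x_1`-slice, so they match
      -- `f - g` in both slices.
      have hsub0 : Submodule.span k (linkVec v ε '' {h : HalfDiagram n | h.defects = l}) ≤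
          (Submodule.span k (linkVec v ε '' {h : HalfDiagram (n + 1) | h.defects = l + 1}) ⊓
            LinearMap.ker (slice n 1)).map (slice n 0) := by
        rw [Submodule.span_le]
        rintro _ ⟨h, hh, rfl⟩
        have hl : h.addDefect.mate (Fin.last n) = Fin.last n := by simp [HalfDiagram.addDefect]
        have hd := h.addDefect.defects_restrict
        rw [if_pos hl, h.restrict_addDefect, hh] at hd
        refine ⟨linkVec v ε h.addDefect, ⟨Submodule.subset_span ⟨_, ?_, rfl⟩, ?_⟩, ?_⟩
        · simp only [Set.mem_ofPred_eq]
          omega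
        · exact LinearMap.mem_ker.2 (by rw [slice_linkVec_of_defect v ε _ hl, if_neg (by simp)])
        · rw [slice_linkVec_of_defect v ε _ hl, if_pos rfl, h.restrict_addDefect]
      obtain ⟨g', hg', hgf'⟩ := hsub0 m0
      rw [slice_ext (f := f - g) (g := g') hgf'.symm (by rw [hd1, LinearMap.mem_ker.1 hg'.2])]
      exact hg'.1

/-! ### Passage from tensor space to coordinates. -/

def coords (k : Type*) [Field k] (n : ℕ) : TensorSpace k n ≃ₗ[k] ((Fin n → Fin 2) → k) :=
  (Basis.piTensorProduct fun _ : Fin n => Pi.basisFun k (Fin 2)).equivFun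

theorem coords_tprod {n : ℕ} (m : Fin n → V k) (b : Fin n → Fin 2) :
    coords k n (PiTensorProduct.tprod k m) b = ∏ p, m p (b p) := by
  rw [coords, Module.Basis.equivFun_apply, Basis.piTensorProduct_repr_tprod_apply]
  simp

theorem coords_xvec {n : ℕ} (a : Fin n → Fin 2) : coords k n (xvec k a) = Pi.single a 1 := by
  funext b
  rw [xvec, coords_tprod]
  by_cases h : b = a
  · simp [h]
  · obtain ⟨p, hp⟩ := Function.ne_iff.1 h
    rw [Pi.single_eq_of_ne h, Finset.prod_eq_zero (Finset.mem_univ p)]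
    simp [hp]

theorem tensorSucc_tprod_tmul {n : ℕ} (m : Fin n → V k) (y : V k) :
    tensorSucc k n (PiTensorProduct.tprod k m ⊗ₜ y) =
      PiTensorProduct.tprod k (Fin.snoc m y : Fin (n + 1) → V k) := by
  rw [tensorSucc, LinearEquiv.trans_apply, TensorProduct.congr_tmul, LinearEquiv.refl_apply,
    PiTensorProduct.subsingletonEquiv_symm_apply]
  rw [← Fin.append_right_eq_snoc m (fun _ : Fin 1 => y)]
  refine Eq.trans ?_ (TensorPower.tprod_mul_tprod k m fun _ : Fin 1 => y)
  refine congrArg (fun z : Fin 1 → V k => TensorPower.mulEquiv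
    (PiTensorProduct.tprod k m ⊗ₜ PiTensorProduct.tprod k z)) (funext fun i => ?_)
  rw [Subsingleton.elim i 0]
  exact dif_pos rfl

theorem coords_tensorSucc {n : ℕ} (x : TensorSpace k n) (y : V k) (a : Fin n → Fin 2) (j : Fin 2) :
    coords k (n + 1) (tensorSucc k n (x ⊗ₜ y)) (Fin.snoc a j : Fin (n + 1) → Fin 2) =
      coords k n x a * y j := by
  induction x using PiTensorProduct.induction_on with
  | smul_tprod r m =>
    rw [← TensorProduct.smul_tmul', map_smul, map_smul, map_smul, tensorSucc_tprod_tmul]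
    simp [coords_tprod, Fin.prod_univ_castSucc, mul_assoc]
  | add x x' h h' =>
    rw [TensorProduct.add_tmul, map_add, map_add, map_add, Pi.add_apply, Pi.add_apply, h, h',
      add_mul]

theorem slice_coords_tensorSucc {n : ℕ} (x : TensorSpace k n) (y : V k) (j : Fin 2) :
    slice n j (coords k (n + 1) (tensorSucc k n (x ⊗ₜ y))) = y j • coords k n x := by
  funext a
  rw [slice_apply, coords_tensorSucc, Pi.smul_apply, smul_eq_mul, mul_comm]

theorem tensorRep_succ (v : kˣ) (n : ℕ) (a : U v) (z : TensorSpace k n ⊗[k] V k) :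
    tensorRep v (n + 1) a (tensorSucc k n z) = tensorSucc k n
      (Module.endTensorEndAlgHom (R := k) (S := k) (A := k)
        (Algebra.TensorProduct.map (tensorRep v n) (natRep v) (U.comul v a)) z) := by
  simp [tensorRep, LinearEquiv.conjAlgEquiv_apply]

theorem comul_K (v : kˣ) : U.comul v (U.gen v .K) = U.gen v .K ⊗ₜ U.gen v .K := U.lift_gen ..

theorem comul_E (v : kˣ) : U.comul v (U.gen v .E) = U.gen v .E ⊗ₜ 1 + U.gen v .K ⊗ₜ U.gen v .E :=
  U.lift_gen ..

theorem natRep_K (v : kˣ) (y : V k) (j : Fin 2) :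
    natRep v (U.gen v .K) y j = ((v ^ siteWeight j : kˣ) : k) * y j := by
  have : natRep v (U.gen v .K) = Matrix.toLin' !![(v : k), 0; 0, (v : k)⁻¹] :=
    congrArg Matrix.toLinAlgEquiv' (U.lift_gen ..)
  rw [this]
  rcases fin2_cases j with rfl | rfl <;> simp [siteWeight, Matrix.mulVec, dotProduct]

theorem natRep_E (v : kˣ) (y : V k) (j : Fin 2) :
    natRep v (U.gen v .E) y j = if j = 0 then y 1 else 0 := by
  have : natRep v (U.gen v .E) = Matrix.toLin' !![(0 : k), 1; 0, 0] :=
    congrArg Matrix.toLinAlgEquiv' (U.lift_gen ..)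
  rw [this]
  rcases fin2_cases j with rfl | rfl <;> simp [Matrix.mulVec, dotProduct]

theorem tensorRep_K_succ (v : kˣ) {n : ℕ} (x : TensorSpace k n) (y : V k) :
    tensorRep v (n + 1) (U.gen v .K) (tensorSucc k n (x ⊗ₜ y)) =
      tensorSucc k n (tensorRep v n (U.gen v .K) x ⊗ₜ natRep v (U.gen v .K) y) := by
  rw [tensorRep_succ, comul_K, Algebra.TensorProduct.map_tmul]
  rfl

theorem tensorRep_E_succ (v : kˣ) {n : ℕ} (x : TensorSpace k n) (y : V k) :
    tensorRep v (n + 1) (U.gen v .E) (tensorSucc k n (x ⊗ₜ y)) =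
      tensorSucc k n (tensorRep v n (U.gen v .E) x ⊗ₜ y) +
      tensorSucc k n (tensorRep v n (U.gen v .K) x ⊗ₜ natRep v (U.gen v .E) y) := by
  rw [tensorRep_succ, comul_E, map_add, map_add, Algebra.TensorProduct.map_tmul,
    Algebra.TensorProduct.map_tmul, map_one, LinearMap.add_apply, map_add]
  rfl

theorem tensorSucc_ext {n : ℕ} {M : Type*} [AddCommGroup M] [Module k M]
    {f g : TensorSpace k (n + 1) →ₗ[k] M}
    (h : ∀ x y, f (tensorSucc k n (x ⊗ₜ y)) = g (tensorSucc k n (x ⊗ₜ y))) : f = g := by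
  have : f ∘ₗ (tensorSucc k n).toLinearMap = g ∘ₗ (tensorSucc k n).toLinearMap :=
    TensorProduct.ext' h
  exact (LinearMap.cancel_right (tensorSucc k n).surjective).1 this

theorem coords_K (v : kˣ) (n : ℕ) (x : TensorSpace k n) :
    coords k n (tensorRep v n (U.gen v .K) x) = torus v n (coords k n x) := by
  induction n with
  | zero =>
    have : U.counit v (U.gen v .K) = 1 := U.lift_gen ..
    funext b
    simp [tensorRep, this, torus_apply, seqWeight]
  | succ n ih =>
    refine DFunLike.congr_fun
      (f := (coords k (n + 1)).toLinearMap ∘ₗ tensorRep v (n + 1) (U.gen v .K))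
      (g := torus v (n + 1) ∘ₗ (coords k (n + 1)).toLinearMap)
      (tensorSucc_ext fun x y => ?_) x
    funext b
    rw [← Fin.snoc_init_self b]
    generalize Fin.init b = a
    generalize b (Fin.last n) = j
    simp only [LinearMap.comp_apply, LinearEquiv.coe_coe, torus_apply, tensorRep_K_succ,
      coords_tensorSucc, ih, natRep_K, seqWeight_snoc, zpow_add, Units.val_mul]
    ring

theorem coords_E (v : kˣ) (n : ℕ) (x : TensorSpace k n) :
    coords k n (tensorRep v n (U.gen v .E) x) = raise v n (coords k n x) := by
  induction n with
  | zero =>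
    have : U.counit v (U.gen v .E) = 0 := U.lift_gen ..
    funext b
    simp [tensorRep, this, raise_apply]
  | succ n ih =>
    refine DFunLike.congr_fun
      (f := (coords k (n + 1)).toLinearMap ∘ₗ tensorRep v (n + 1) (U.gen v .E))
      (g := raise v (n + 1) ∘ₗ (coords k (n + 1)).toLinearMap)
      (tensorSucc_ext fun x y => ?_) x
    simp only [LinearMap.comp_apply, LinearEquiv.coe_coe, tensorRep_E_succ, map_add]
    refine slice_ext ?_ ?_
    · simp [slice_zero_raise, slice_coords_tensorSucc, ih, coords_K, natRep_E]
    · simp [slice_one_raise, slice_coords_tensorSucc, ih, natRep_E]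

/-- Otherwise `v ^ 2 = -1`, hence `v ^ 4 = 1`. -/
theorem add_inv_ne_zero_of_not_root {v : kˣ} (hv : ∀ m : ℕ, 0 < m → v ^ m ≠ 1) :
    (v : k) + (v : k)⁻¹ ≠ 0 := by
  intro h
  have h1 : (v : k) * v = -1 := by
    have := congrArg ((v : k) * ·) h
    simp only [mul_add, mul_inv_cancel₀ v.ne_zero, mul_zero] at this
    linear_combination this
  refine hv 4 (by norm_num) (Units.ext ?_)
  push_cast
  linear_combination ((v : k) * v - 1) * h1

theorem coords_tensorGen (v : kˣ) (ε : ℤˣ) (hv : (v : k) + (v : k)⁻¹ ≠ 0) {n : ℕ}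
    (i : Fin (n - 1)) (x : TensorSpace k n) :
    coords k n (tensorGen v ε i x) = coordGen v ε i (coords k n x) := by
  have hne := posL_ne_posR i
  have hsw : ∀ (a : Fin n → Fin 2) (s t : Fin 2), a (posL i) = s → a (posR i) = t →
      Function.update (Function.update a (posL i) t) (posR i) s =
        fun p => a (Equiv.swap (posL i) (posR i) p) := by
    intro a s t hs ht
    funext p
    by_cases h1 : p = posR i
    · simp [h1, hs]
    · by_cases h2 : p = posL i
      · simp [h2, hne, ht]
      · simp [h1, h2, Equiv.swap_apply_of_ne_of_ne]
  have hflip : ∀ a b : Fin n → Fin 2, (b = fun p => a (Equiv.swap (posL i) (posR i) p)) ↔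
      (fun p => b (Equiv.swap (posL i) (posR i) p)) = a := by
    intro a b
    constructor
    · rintro rfl
      funext p
      simp
    · rintro rfl
      funext p
      simp
  suffices coords k n ∘ₗ tensorGen v ε i = coordGen v ε i ∘ₗ (coords k n).toLinearMap from
    DFunLike.congr_fun this x
  -- Conjugated back, the identity compares endomorphisms of tensor space, so `tensor_end_ext`
  -- reduces it to basis tensors.
  have : tensorGen v ε i =
      (coords k n).symm ∘ₗ coordGen v ε i ∘ₗ (coords k n).toLinearMap := by
    refine tensor_end_ext fun a => (coords k n).injective ?_
    simp only [LinearMap.comp_apply, LinearEquiv.coe_coe, LinearEquiv.apply_symm_apply]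
    funext b
    rw [coordGen_apply]
    rcases fin2_cases (a (posL i)) with h0 | h0 <;> rcases fin2_cases (a (posR i)) with h1 | h1
    · rw [tensorGen_xvec_same v ε i a (h0.trans h1.symm), coords_xvec, map_zero]
      split_ifs with h2
      · rfl
      all_goals
        rw [Pi.single_eq_of_ne, Pi.single_eq_of_ne]
        · simp
        · rintro rfl
          simp at h0 h1
          exact h2 (h1.trans h0.symm)
        · rintro rfl
          exact h2 (h0.trans h1.symm)
    · rw [tensorGen_xvec_01 v ε hv i a h0 h1, hsw a 0 1 h0 h1]
      simp only [map_smul, map_sub, coords_xvec, Pi.smul_apply, Pi.sub_apply, smul_eq_mul,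
        Pi.single_apply, hflip a b]
      split_ifs <;> grind
    · rw [tensorGen_xvec_10 v ε hv i a h0 h1, hsw a 1 0 h0 h1]
      simp only [map_smul, map_sub, coords_xvec, Pi.smul_apply, Pi.sub_apply, smul_eq_mul,
        Pi.single_apply, hflip a b]
      split_ifs <;> grind
    · rw [tensorGen_xvec_same v ε i a (h0.trans h1.symm), coords_xvec, map_zero]
      split_ifs with h2
      · rfl
      all_goals
        rw [Pi.single_eq_of_ne, Pi.single_eq_of_ne]
        · simp
        · rintro rfl
          simp at h0 h1
          exact h2 (h1.trans h0.symm)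
        · rintro rfl
          exact h2 (h0.trans h1.symm)
  rw [this]
  ext x
  simp

/-! ### Weight spaces and maximal vectors through coordinates. -/

theorem mem_weightSpace_iff {v : kˣ} (hv : ∀ m : ℕ, 0 < m → v ^ m ≠ 1) {n : ℕ} {μ : ℤ}
    {w : TensorSpace k n} :
    w ∈ weightSpace v n μ ↔ coords k n w ∈ coordWeightSpace k n μ := by
  rw [weightSpace, Module.End.mem_eigenspace_iff, ← (coords k n).injective.eq_iff, coords_K,
    map_smul]
  exact ⟨mem_of_torus hv, torus_of_mem v⟩

theorem mem_maxSpace_iff {v : kˣ} {n l : ℕ} {w : TensorSpace k n} :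
    w ∈ maxSpace v n l ↔ w ∈ weightSpace v n l ∧ tensorRep v n (U.gen v .E) w = 0 := by
  simp [maxSpace, and_comm]

theorem mem_maxSpace_iff_coords {v : kˣ} (hv : ∀ m : ℕ, 0 < m → v ^ m ≠ 1) {n l : ℕ}
    {w : TensorSpace k n} : w ∈ maxSpace v n l ↔
      coords k n w ∈ coordWeightSpace k n l ∧ raise v n (coords k n w) = 0 := by
  rw [mem_maxSpace_iff, mem_weightSpace_iff hv, ← coords_E, LinearEquiv.map_eq_zero_iff]

theorem isMaximalVector_iff {v : kˣ} {n l : ℕ} {w : TensorSpace k n} :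
    IsMaximalVector v (tensorRep v n) l w ↔ w ∈ maxSpace v n l ∧ w ≠ 0 := by
  rw [mem_maxSpace_iff, weightSpace, Module.End.mem_eigenspace_iff]
  exact ⟨fun h => ⟨⟨h.weight, h.killed⟩, h.ne_zero⟩, fun h => ⟨h.2, h.1.1, h.1.2⟩⟩

/-! ### The weight decomposition -/

theorem exists_seqWeight_eq {n : ℕ} (a : Fin n → Fin 2) :
    ∃ c : ℕ, c ≤ n ∧ seqWeight a = n - 2 * c := by
  induction n with
  | zero => exact ⟨0, le_rfl, by simp [seqWeight]⟩
  | succ n ih =>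
    obtain ⟨c, hc, h⟩ := ih (Fin.init a)
    rw [← Fin.snoc_init_self a, seqWeight_snoc, h]
    rcases fin2_cases (a (Fin.last n)) with h1 | h1 <;> rw [h1]
    · exact ⟨c, by omega, by simp [siteWeight]; ring⟩
    · exact ⟨c + 1, by omega, by simp [siteWeight]; ring⟩

theorem seqWeight_mem_signedIndex {n : ℕ} (a : Fin n → Fin 2) : seqWeight a ∈ signedIndex n := by
  obtain ⟨c, hc, h⟩ := exists_seqWeight_eq a
  simp only [signedIndex, cellIndex, Finset.mem_union, Finset.mem_image, Finset.mem_range,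
    exists_exists_and_eq_and]
  rcases le_total (2 * c) n with h1 | h1
  · exact Or.inl ⟨c, by omega, by omega⟩
  -- For `2 c ≥ n` the weight `n - 2 c` is the negative of `n - 2 (n - c)`.
  · exact Or.inr ⟨n - c, by omega, by omega⟩

/-- Eigenspaces of `K` for distinct eigenvalues are independent, and the basis tensors are weight
vectors with weights in `±Λ(n)`. -/
theorem isInternal_weightSpace {v : kˣ} (hv : ∀ m : ℕ, 0 < m → v ^ m ≠ 1) (n : ℕ) :
    DirectSum.IsInternal fun μ : {μ : ℤ // μ ∈ signedIndex n} => weightSpace v n μ := by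
  rw [DirectSum.isInternal_submodule_iff_iSupIndep_and_iSup_eq_top]
  constructor
  · refine (Module.End.eigenspaces_iSupIndep (tensorRep v n (U.gen v .K))).comp
      (f := fun μ : {μ : ℤ // μ ∈ signedIndex n} => ((v ^ (μ : ℤ) : kˣ) : k)) fun μ ν h => ?_
    exact Subtype.ext (zpow_injective_of_not_root hv (Units.ext h))
  · rw [eq_top_iff, ← (Basis.piTensorProduct fun _ : Fin n => Pi.basisFun k (Fin 2)).span_eq,
      Submodule.span_le]
    rintro _ ⟨a, rfl⟩
    have h : xvec k a ∈ weightSpace v n (seqWeight a) := by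
      rw [mem_weightSpace_iff hv, coords_xvec]
      intro b hb
      exact Pi.single_eq_of_ne (fun e => hb (by rw [e])) _
    rw [Basis.piTensorProduct_apply]
    simp only [Pi.basisFun_apply]
    exact Submodule.mem_iSup_of_mem
      (p := fun μ : {μ : ℤ // μ ∈ signedIndex n} => weightSpace v n μ)
      ⟨seqWeight a, seqWeight_mem_signedIndex a⟩ h

/-! ### The isomorphism of the cell module with the space of maximal vectors -/

theorem HalfDiagram.defects_stack_lt {n : ℕ} (i : Fin (n - 1)) (h : HalfDiagram n)
    (hL : h.mate (posL i) = posL i) (hR : h.mate (posR i) = posR i) :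
    (h.stack i).defects < h.defects := by
  have hm := h.mate_mate
  have hne := posL_ne_posR i
  refine Finset.card_lt_card ((Finset.ssubset_iff_of_subset ?_).2 ⟨posL i, ?_, ?_⟩)
  · intro j
    simp only [Finset.mem_filter, Finset.mem_univ, true_and, stack, stackMate]
    grind
  · simpa using hL
  · rw [Finset.mem_filter]
    simp [stack, stackMate, hne.symm]

theorem loopValue_ne_zero {v : kˣ} (hv : (v : k) + (v : k)⁻¹ ≠ 0) (ε : ℤˣ) :
    loopValue v ε ≠ 0 :=
  mul_ne_zero (left_ne_zero_of_mul_eq_one (sign_mul_self k ε)) hv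

/-- A combinatorial fact read off from weights: `e_i` preserves weights and sends the link vector of
`h` to a nonzero multiple of that of `h.stack i`, so this nonzero vector has both defect numbers as
its weight. The choice of sign `1` is immaterial. -/
theorem defects_stack_eq {v : kˣ} (hv : (v : k) + (v : k)⁻¹ ≠ 0) {n : ℕ}
    (i : Fin (n - 1)) (h : HalfDiagram n)
    (hd : ¬(h.mate (posL i) = posL i ∧ h.mate (posR i) = posR i)) :
    (h.stack i).defects = h.defects := by
  have h1 := coordGen_mem v 1 i (linkVec_mem v 1 h)
  rw [coordGen_linkVec v 1 i h hd] at h1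
  obtain ⟨b, hb⟩ := Function.ne_iff.1 ((linearIndependent_linkVec v 1 n).ne_zero (h.stack i))
  by_contra hne
  have h2 : seqWeight b = (h.stack i).defects := by
    by_contra h3
    exact hb (linkVec_mem v 1 _ b h3)
  have h3 := h1 b (by rw [h2]; exact_mod_cast hne)
  rw [Pi.smul_apply, smul_eq_mul] at h3
  exact hb ((mul_eq_zero.1 h3).resolve_left (pow_ne_zero _ (loopValue_ne_zero hv 1)))

/-- The map sending a half-diagram with `l` defects to its link vector and the others to `0`. -/
def linkMap (v : kˣ) (ε : ℤˣ) (n l : ℕ) : HHat k n (loopValue v ε) →ₗ[k] TensorSpace k n :=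
  (coords k n).symm.toLinearMap ∘ₗ
    (Finsupp.linearCombination k fun h : HalfDiagram n =>
      if h.defects = l then linkVec v ε h else 0)

theorem coords_linkMap (v : kˣ) (ε : ℤˣ) (n l : ℕ) (x : HHat k n (loopValue v ε)) :
    coords k n (linkMap v ε n l x) = Finsupp.linearCombination k (fun h : HalfDiagram n =>
      if h.defects = l then linkVec v ε h else 0) x :=
  (coords k n).apply_symm_apply _

theorem coords_linkMap_of (v : kˣ) (ε : ℤˣ) (n l : ℕ) (h : HalfDiagram n) :
    coords k n (linkMap v ε n l (HHat.of (loopValue v ε) h)) =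
      if h.defects = l then linkVec v ε h else 0 := by
  rw [coords_linkMap]
  exact (Finsupp.linearCombination_single k _ _).trans (one_smul _ _)

theorem linkMap_mem {v : kˣ} (hv : ∀ m : ℕ, 0 < m → v ^ m ≠ 1) (ε : ℤˣ) (n l : ℕ)
    (x : HHat k n (loopValue v ε)) : linkMap v ε n l x ∈ maxSpace v n l := by
  rw [mem_maxSpace_iff_coords hv, coords_linkMap]
  have : LinearMap.range (Finsupp.linearCombination k (fun h : HalfDiagram n =>
      if h.defects = l then linkVec v ε h else 0)) ≤
      coordWeightSpace k n l ⊓ LinearMap.ker (raise v n) := by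
    rw [Finsupp.range_linearCombination, Submodule.span_le]
    rintro _ ⟨h, rfl⟩
    by_cases hd : h.defects = l
    · simp only [if_pos hd]
      exact ⟨hd ▸ linkVec_mem v ε h, raise_linkVec v ε h⟩
    · simp only [if_neg hd]
      exact Submodule.zero_mem _
  exact this ⟨x, rfl⟩

theorem mem_le_iff {δ : k} {n l : ℕ} {x : HHat k n δ} :
    x ∈ HHat.le k n δ l ↔
      x ∈ Submodule.span k (HHat.of δ '' {h : HalfDiagram n | h.defects ≤ l}) := Iff.rfl

/-- Restricting to at most `l` defects matters: a diagram with more defects is sent to `0` by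
`linkMap`, but stacking may bring it down to exactly `l` defects. -/
theorem linkMap_e_smul {v : kˣ} (hv : (v : k) + (v : k)⁻¹ ≠ 0) (ε : ℤˣ)
    {n l : ℕ} (i : Fin (n - 1)) {x : HHat k n (loopValue v ε)}
    (hx : x ∈ HHat.le k n (loopValue v ε) l) :
    linkMap v ε n l ((TL.e i : TL k n (loopValue v ε)) • x) =
      tensorGen v ε i (linkMap v ε n l x) := by
  refine (coords k n).injective ?_
  rw [coords_tensorGen v ε hv]
  rw [mem_le_iff] at hx
  induction hx using Submodule.span_induction with
  | mem x hx =>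
    obtain ⟨h, hh, rfl⟩ := hx
    rw [HHat.e_smul_of, map_smul, map_smul, coords_linkMap_of, coords_linkMap_of]
    rcases (show h.defects ≤ l from hh).lt_or_eq with hlt | heq
    · rw [if_neg hlt.ne, if_neg ((h.defects_stack_le i).trans_lt hlt).ne, smul_zero, map_zero]
    · rw [if_pos heq]
      by_cases hd : h.mate (posL i) = posL i ∧ h.mate (posR i) = posR i
      · rw [if_neg (heq ▸ (h.defects_stack_lt i hd.1 hd.2).ne), smul_zero,
          coordGen_linkVec_of_defects v ε i h hd.1 hd.2]
      · rw [if_pos ((defects_stack_eq hv i h hd).trans heq), coordGen_linkVec v ε i h hd]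
  | zero => simp
  | add x y _ _ hx hy => simp only [smul_add, map_add, hx, hy]
  | smul r x _ hx =>
    have : (TL.e i : TL k n (loopValue v ε)) • r • x = r • (TL.e i : TL k n (loopValue v ε)) • x := by
      rw [HHat.smul_def, map_smul, HHat.smul_def]
    simp only [this, map_smul, hx]

theorem linkMap_smul {v : kˣ} (hv : (v : k) + (v : k)⁻¹ ≠ 0) (ε : ℤˣ)
    {n l : ℕ} (a : TL k n (loopValue v ε)) {x : HHat k n (loopValue v ε)}
    (hx : x ∈ HHat.le k n (loopValue v ε) l) :
    linkMap v ε n l (a • x) = tensorTLRep v ε n a (linkMap v ε n l x) := by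
  induction a using TL.induction generalizing x with
  | halg r => rw [algebraMap_smul, map_smul, AlgHom.commutes, Module.algebraMap_end_apply]
  | he i => rw [linkMap_e_smul hv ε i hx, tensorTLRep, TL.lift_e]
  | hadd a b ha hb => rw [add_smul, map_add, map_add, ha hx, hb hx, LinearMap.add_apply]
  | hmul a b ha hb =>
    rw [mul_smul, ha (Submodule.smul_mem _ b hx), hb hx, map_mul, Module.End.mul_apply]

/-- Independence of the link vectors forces the coefficients of all diagrams with exactly `l`
defects to vanish. -/
theorem mem_lt_of_linkMap_eq_zero (v : kˣ) (ε : ℤˣ) {n l : ℕ} {x : HHat k n (loopValue v ε)}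
    (hx : x ∈ HHat.le k n (loopValue v ε) l) (h0 : linkMap v ε n l x = 0) :
    x ∈ HHat.lt k n (loopValue v ε) l := by
  have h1 := coords_linkMap v ε n l x
  rw [h0, map_zero] at h1
  let y : HalfDiagram n →₀ k := x
  have hy : y ∈ Finsupp.supported k k {h : HalfDiagram n | h.defects ≤ l} := by
    rw [Finsupp.supported_eq_span_single]
    exact hx
  have h2 : ∑ h ∈ y.support, (if h.defects = l then y h else 0) • linkVec v ε h = 0 := by
    refine Eq.trans (Finset.sum_congr rfl fun h _ => ?_) h1.symm
    by_cases hd : h.defects = l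
    · simp only [if_pos hd]
      rfl
    · simp only [if_neg hd, zero_smul]
      exact (smul_zero (y h)).symm
  have h3 := linearIndependent_iff'.1 (linearIndependent_linkVec (k := k) v ε n) _ _ h2
  have h4 : y ∈ Finsupp.supported k k {h : HalfDiagram n | h.defects < l} := by
    rw [Finsupp.mem_supported]
    intro h hh
    refine lt_of_le_of_ne (show h.defects ≤ l from (Finsupp.mem_supported k y).1 hy hh) fun e => ?_
    have := h3 h hh
    rw [if_pos e] at this
    exact Finsupp.mem_support_iff.1 hh this
  rw [Finsupp.supported_eq_span_single] at h4
  exact h4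

theorem linkMap_eq_zero_of_mem_lt (v : kˣ) (ε : ℤˣ) {n l : ℕ} {x : HHat k n (loopValue v ε)}
    (hx : x ∈ HHat.lt k n (loopValue v ε) l) : linkMap v ε n l x = 0 := by
  have : Submodule.span k (HHat.of (loopValue v ε) '' {h : HalfDiagram n | h.defects < l}) ≤
      LinearMap.ker (linkMap v ε n l) := by
    rw [Submodule.span_le]
    rintro _ ⟨h, hh, rfl⟩
    refine (coords k n).injective ?_
    rw [coords_linkMap_of, if_neg (ne_of_lt hh), map_zero]
  exact this hx

theorem exists_linkMap_eq {v : kˣ} (hv : ∀ m : ℕ, 0 < m → v ^ m ≠ 1) (ε : ℤˣ) {n l : ℕ}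
    {w : TensorSpace k n} (hw : w ∈ maxSpace v n l) :
    ∃ x ∈ HHat.le k n (loopValue v ε) l, linkMap v ε n l x = w := by
  rw [mem_maxSpace_iff_coords hv] at hw
  have h1 := mem_span_linkVec hv ε n l _ hw.1 hw.2
  have h2 : Submodule.span k (linkVec v ε '' {h : HalfDiagram n | h.defects = l}) ≤
      (Submodule.span k (HHat.of (loopValue v ε) '' {h : HalfDiagram n | h.defects ≤ l})).map
        ((coords k n).toLinearMap ∘ₗ linkMap v ε n l) := by
    rw [Submodule.span_le]
    rintro _ ⟨h, hh, rfl⟩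
    exact ⟨HHat.of _ h, Submodule.subset_span ⟨h, le_of_eq hh, rfl⟩,
      (coords_linkMap_of v ε n l h).trans (if_pos hh)⟩
  obtain ⟨x, hx, hxw⟩ := h2 h1
  exact ⟨x, hx, (coords k n).injective hxw⟩

/-- A `k`-linear map on an `R`-module `X`, equivariant on the submodule `A` and with kernel `B`
there, induces an equivariant isomorphism of `A / B` with its image. -/
theorem exists_quotient_equiv {R X W : Type*} [Ring R] [Algebra k R] [AddCommGroup X]
    [Module R X] [Module k X] [IsScalarTower k R X] [AddCommGroup W] [Module k W]
    (ρ : R →ₐ[k] Module.End k W) (A B : Submodule R X) (N : Submodule k W) (Φ : X →ₗ[k] W)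
    (hN : ∀ x, Φ x ∈ N) (hker : ∀ x ∈ A, Φ x = 0 → x ∈ B) (hB : ∀ x ∈ B, Φ x = 0)
    (hsurj : ∀ w ∈ N, ∃ x ∈ A, Φ x = w) (hρ : ∀ a, ∀ x ∈ A, Φ (a • x) = ρ a (Φ x)) :
    ∃ φ : (A ⧸ B.submoduleOf A) ≃ₗ[k] N, ∀ a x, (φ (a • x) : W) = ρ a (φ x) := by
  let f : A →ₗ[k] N := (Φ ∘ₗ A.subtype.restrictScalars k).codRestrict N fun x => hN x
  have hf : Function.Surjective f := by
    rintro ⟨w, hw⟩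
    obtain ⟨x, hx, rfl⟩ := hsurj w hw
    exact ⟨⟨x, hx⟩, rfl⟩
  have hP : (B.submoduleOf A).restrictScalars k = LinearMap.ker f := by
    ext x
    rw [LinearMap.mem_ker, ← Subtype.coe_inj]
    exact ⟨fun h => hB x h, fun h => hker x x.2 h⟩
  refine ⟨(Submodule.Quotient.restrictScalarsEquiv k (B.submoduleOf A)).symm.trans
    ((Submodule.quotEquivOfEq _ _ hP).trans (f.quotKerEquivOfSurjective hf)), fun a x => ?_⟩
  obtain ⟨x, rfl⟩ := Submodule.Quotient.mk_surjective _ x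
  exact hρ a x x.2

end TLSW

end

theorem corollary8p4 {k : Type*} [Field k] (v : kˣ) (hv : ∀ m : ℕ, 0 < m → v ^ m ≠ 1)
    (ε : ℤˣ) (n : ℕ) :
    DirectSum.IsInternal
      (fun μ : {μ : ℤ // μ ∈ TLSW.signedIndex n} => TLSW.weightSpace v n μ) ∧
    ∀ l ∈ TLSW.cellIndex n,
      (∀ w : TLSW.TensorSpace k n,
        TLSW.IsMaximalVector v (TLSW.tensorRep v n) l w ↔ w ∈ TLSW.maxSpace v n l ∧ w ≠ 0) ∧
      (∀ a : TLSW.TL k n (TLSW.loopValue v ε), ∀ w ∈ TLSW.maxSpace v n l,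
        TLSW.tensorTLRep v ε n a w ∈ TLSW.maxSpace v n l) ∧
      ∃ φ : TLSW.CellModule k n (TLSW.loopValue v ε) l ≃ₗ[k] TLSW.maxSpace v n l,
        ∀ (a : TLSW.TL k n (TLSW.loopValue v ε))
          (x : TLSW.CellModule k n (TLSW.loopValue v ε) l),
          (φ (a • x) : TLSW.TensorSpace k n) = TLSW.tensorTLRep v ε n a (φ x) := by
  have hv0 := TLSW.add_inv_ne_zero_of_not_root hv
  refine ⟨TLSW.isInternal_weightSpace hv n, fun l _ => ⟨fun w => TLSW.isMaximalVector_iff,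
    fun a w hw => ?_, TLSW.exists_quotient_equiv _ _ _ _ (TLSW.linkMap v ε n l)
      (TLSW.linkMap_mem hv ε n l) (fun _ => TLSW.mem_lt_of_linkMap_eq_zero v ε)
      (fun _ => TLSW.linkMap_eq_zero_of_mem_lt v ε) (fun _ => TLSW.exists_linkMap_eq hv ε)
      fun a _ => TLSW.linkMap_smul hv0 ε a⟩⟩
  -- Stability needs no commutation of the two actions: a maximal vector is `linkMap x`, and `a`
  -- sends it to `linkMap (a • x)`, which again lies in `maxSpace`.
  obtain ⟨x, hx, rfl⟩ := TLSW.exists_linkMap_eq hv ε hw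
  rw [← TLSW.linkMap_smul hv0 ε a hx]
  exact TLSW.linkMap_mem hv ε n l _
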